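/- **Setting.** Let $d,m\ge 1$. Cubes are axis-parallel cubes in $\mathbb R^d$, $tQ$ is the dilate of $Q$ by $t$ about its centre, $(f)_{q,Q}=|Q|^{-1/q}\|f\mathbf 1_Q\|_{L^q}$, and $M_pf(x)=\sup_{Q\ni x}(f)_{p,Q}$. A collection $\mathcal S$ of cubes is $\eta$-sparse if there are pairwise disjoint measurable $E_Q\subset Q$ ($Q\in\mathcal S$) with $|E_Q|\ge\eta|Q|$, and $$\mathrm{PSF}^{\vec p}_{\mathcal S}(f_1,\dots,f_{m+1})=\sum_{Q\in\mathcal S}|Q|\prod_{i=1}^{m+1}(f_i)_{p_i,Q}.$$ *Kernels.* Let $K_s$ ($s\in\mathbb Z$) be measurable functions on $(\mathbb R^d)^{m+1}$ (the single-scale pieces of the kernel $K=\sum_sK_s$ of an $m$-linear operator $T$) such that $|x_k-x_l|\le 2^s$ for all $k,l$ on the support of $K_s$, and such that for some $q\in[1,\infty]$, with $q'$ its conjugate exponent, $$[K]_q=\sup_{s}2^{mds/q'}\sup_{y\in\mathbb R^d}\big(\|K_s(y,\cdot+y,\dots,\cdot+y)\|_{L^q(\mathbb R^{md})}+\dots+\|K_s(\cdot+y,\dots,\cdot+y,y)\|_{L^q(\mathbb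 R^{md})}\big)<\infty .$$ For integers $\mu,\nu$ put $$\Lambda_\mu^\nu(f_1,\dots,f_{m+1})=\int_{\mathbb R^{(m+1)d}}\sum_{\mu<s<\nu}K_s(x_1,\dots,x_{m+1})f_1(x_1)\cdots f_{m+1}(x_{m+1})\,dx_1\cdots dx_{m+1}.$$ Let $r_i,\alpha\in[1,\infty]$ with $\frac1{r_1}+\dots+\frac1{r_m}=\frac1\alpha$, let $\alpha'$ be the conjugate exponent of $\alpha$, and suppose $$C_T=\sup_{\mu,\nu}\|\Lambda_\mu^\nu\|_{L^{r_1}\times\dots\times L^{r_m}\times L^{\alpha'}\to\mathbb C}<\infty .$$ *Stopping collections.* For a cube $L$ of side $2^{s_L}$ in a dyadic lattice $\mathcal D$ let $\hat L=2^5L$. A collection $\mathcal P\subset\mathcal D$ of pairwise disjoint cubes is a stopping collection with top $Q\in\mathcal D$ if its cubes are contained in $3Q$, if $7L\cap 7R=\emptyset$ whenever $L,R\in\mathcal P$ and $|s_L-s_R|\ge 8$, and if $\bigcup_{L\in\mathcal P,\,3L\cap 2Q\ne\emptyset}9L\subset\bigcup_{L\in\mathcal P}L$. For functions $h$ supported in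 $3Q$ set $\|h\|_{\mathcal Y_\infty}=\|h\|_\infty$ and, for $p<\infty$, $$\|h\|_{\mathcal Y_p}=\max\Big(\big\|h\mathbf 1_{\mathbb R^d\setminus\bigcup_{L\in\mathcal P}L}\big\|_\infty,\ \sup_{L\in\mathcal P}\inf_{x\in\hat L}M_ph(x)\Big).$$ $\dot{\mathcal X}_p$ is the space of $b=\sum_{L\in\mathcal P}b_L$ in $\mathcal Y_p$ with $b_L$ supported on $L$ and $\int b_L=0$, with the norm of $\mathcal Y_p$. Let $\Lambda_L(f_1,\dots,f_{m+1})$ be the form $\Lambda_\mu^\nu(f_1\mathbf 1_L,f_2,\dots,f_{m+1})$ restricted to the scales $s\le s_L$, and $$\Lambda_{\mathcal P}=\Lambda_Q-\sum_{L\in\mathcal P,\,L\subset Q}\Lambda_L .$$ **Theorem.** Let $1\le p_1,\dots,p_{m+1}\le\infty$ and $C_L>0$ be such that, for all finite truncations $\mu,\nu$, all dyadic lattices, all stopping collections $\mathcal P$ (with top $Q$) and all $n=1,\dots,m+1$, $$|\Lambda_{\mathcal P}(g_1,\dots,g_{n-1},b,g_{n+1},\dots,g_{m+1})|\le C_L\,|Q|\,\Big(\prod_{j<n}\|g_j\|_{\mathcal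 Y_\infty}\Big)\|b\|_{\dot{\mathcal X}_{p_n}}\Big(\prod_{j>n}\|g_j\|_{\mathcal Y_{p_j}}\Big)$$ for all $b\in\dot{\mathcal X}_{p_n}$, $g_j\in\mathcal Y_\infty$ ($j<n$), $g_j\in\mathcal Y_{p_j}$ ($j>n$) for which the integrals defining the forms converge absolutely. Then, with a constant $c_d$ depending only on $d$ and a sparsity constant $\eta\in(0,1)$ depending only on $d$ and $m$, $$\sup_{\mu,\nu}|\Lambda_\mu^\nu(f_1,\dots,f_{m+1})|\le c_d\,[C_T+C_L]\,\sup_{\mathcal S\ \eta\text{-sparse}}\mathrm{PSF}^{(p_1,\dots,p_{m+1})}_{\mathcal S}(f_1,\dots,f_{m+1})$$ for all $f_j\in L^{p_j}(\mathbb R^d)$ with compact support, the supremum on the left being over the truncations for which the integral converges absolutely (which is automatic for bounded $f_j$). -/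

import Mathlib

open MeasureTheory Set
open scoped ENNReal NNReal

noncomputable section

namespace SparseForm

/-- Euclidean space `ℝ^d` with its Euclidean norm. -/
abbrev Space (d : ℕ) : Type := EuclideanSpace ℝ (Fin d)

/-! ### Cubes -/

/-- An axis-parallel cube in `ℝ^d`, given by its lower corner and its side length. -/
structure Cube (d : ℕ) where
  corner : Space d
  side : ℝ
  side_pos : 0 < side

namespace Cube

variable {d : ℕ}

/-- The points of the (half-open) cube. -/
def carrier (Q : Cube d) : Set (Space d) :=
  {x | ∀ i, Q.corner i ≤ x i ∧ x i < Q.corner i + Q.side}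

/-- The concentric dilate `t Q`. -/
def dilate (t : ℝ) (Q : Cube d) : Set (Space d) :=
  {x | ∀ i, Q.corner i - (t - 1) / 2 * Q.side ≤ x i ∧
    x i < Q.corner i + (t + 1) / 2 * Q.side}

/-- The scale `s_Q = log₂ (side length of Q)`. -/
def scale (Q : Cube d) : ℝ := Real.logb 2 Q.side

end Cube

/-- A dyadic lattice: for every `k : ℤ` the cubes of side `2 ^ k` form a translate of the grid
`2 ^ k (n + [0,1)^d)`, `n ∈ ℤ^d`, and each grid refines the next coarser one. -/
def IsDyadicLattice {d : ℕ} (D : Set (Cube d)) : Prop :=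
  ∃ a : ℤ → Space d,
    (∀ k : ℤ, ∃ n : Fin d → ℤ, ∀ i, a (k + 1) i - a k i = (2 : ℝ) ^ k * n i) ∧
    D = {Q | ∃ (k : ℤ) (n : Fin d → ℤ), Q.side = (2 : ℝ) ^ k ∧
      ∀ i, Q.corner i = a k i + (2 : ℝ) ^ k * n i}

/-- `P` is a stopping collection with top `Q` in the dyadic lattice `D`: pairwise disjoint cubes
of `D` contained in `3Q` with the two separation properties. -/
structure IsStoppingCollection {d : ℕ} (D P : Set (Cube d)) (Q : Cube d) : Prop where
  top_mem : Q ∈ D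
  subset : P ⊆ D
  disjoint : P.PairwiseDisjoint Cube.carrier
  contained : ∀ L ∈ P, L.carrier ⊆ Q.dilate 3
  separated : ∀ L ∈ P, ∀ R ∈ P, 8 ≤ |L.scale - R.scale| → Disjoint (L.dilate 7) (R.dilate 7)
  covered : ⋃ L ∈ {L ∈ P | (L.dilate 3 ∩ Q.dilate 2).Nonempty}, L.dilate 9 ⊆
    ⋃ L ∈ P, L.carrier

/-! ### Averages, maximal functions, positive sparse forms -/

/-- The average `(f)_{q,Q} = |Q|^{-1/q} ‖f 1_Q‖_q`. -/
def average {d : ℕ} (f : Space d → ℂ) (q : ℝ≥0∞) (Q : Cube d) : ℝ≥0∞ :=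
  volume Q.carrier ^ (-(q⁻¹).toReal) * eLpNorm (Q.carrier.indicator f) q volume

/-- The `p`-th Hardy-Littlewood maximal function, over all cubes containing the point. -/
def maximal {d : ℕ} (p : ℝ≥0∞) (f : Space d → ℂ) (x : Space d) : ℝ≥0∞ :=
  ⨆ (Q : Cube d) (_ : x ∈ Q.carrier), average f p Q

/-- `S` is an `η`-sparse collection of cubes. -/
def IsSparse {d : ℕ} (η : ℝ) (S : Set (Cube d)) : Prop :=
  ∃ E : Cube d → Set (Space d),
    (∀ Q ∈ S, MeasurableSet (E Q) ∧ E Q ⊆ Q.carrier ∧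
      ENNReal.ofReal η * volume Q.carrier ≤ volume (E Q)) ∧
    S.PairwiseDisjoint E

/-- The positive sparse form `∑_{Q ∈ S} |Q| ∏_i (f_i)_{p_i,Q}`. -/
def PSF {d n : ℕ} (S : Set (Cube d)) (p : Fin n → ℝ≥0∞) (f : Fin n → Space d → ℂ) : ℝ≥0∞ :=
  ∑' Q : S, volume (Q : Cube d).carrier * ∏ i, average (f i) (p i) Q

/-! ### The norms attached to a stopping collection -/

open Classical in
/-- The `𝒴_p(P)` norm. -/
def yNorm {d : ℕ} (P : Set (Cube d)) (p : ℝ≥0∞) (h : Space d → ℂ) : ℝ≥0∞ :=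
  if p = ∞ then eLpNorm h ∞ volume
  else max (eLpNorm ((⋃ L ∈ P, L.carrier)ᶜ.indicator h) ∞ volume)
    (⨆ L ∈ P, ⨅ x ∈ L.dilate (2 ^ 5), maximal p h x)

/-- `h` is an element of `𝒴_p(P)`, where `P` has top `Q`. -/
def MemY {d : ℕ} (P : Set (Cube d)) (Q : Cube d) (p : ℝ≥0∞) (h : Space d → ℂ) : Prop :=
  AEStronglyMeasurable h volume ∧ Function.support h ⊆ Q.dilate 3 ∧ yNorm P p h < ∞

/-- `b = ∑_{L ∈ P} b_L` with `b_L` supported on `L` and of mean zero. Together with `MemY` this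
says that `b` belongs to `𝒳̇_p(P)`, whose norm is the `𝒴_p(P)` norm. -/
def IsMeanZeroOn {d : ℕ} (P : Set (Cube d)) (b : Space d → ℂ) : Prop :=
  Function.support b ⊆ ⋃ L ∈ P, L.carrier ∧
    ∀ L ∈ P, IntegrableOn b L.carrier volume ∧ ∫ x in L.carrier, b x = 0

/-! ### Kernels and forms -/

/-- A family of kernels on `(ℝ^d)^{m+1}`, one for each scale `s : ℤ`. -/
abbrev Kernels (d m : ℕ) : Type := ℤ → (Fin (m + 1) → Space d) → ℂ

/-- The size constant `[K]_q`: the supremum over `s` of `2^{mds/q'}` times the supremum over `y` of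
the sum over the positions `i` of the `L^q(ℝ^{md})` norms of `K_s(· + y, …, y, …, · + y)`, with `y`
in position `i`. -/
def kernelSize {d m : ℕ} (K : Kernels d m) (q : ℝ≥0∞) : ℝ≥0∞ :=
  ⨆ s : ℤ, ENNReal.ofReal ((2 : ℝ) ^ ((m : ℝ) * d * s * (1 - (q⁻¹).toReal))) *
    ⨆ y : Space d, ∑ i : Fin (m + 1),
      eLpNorm (fun z : Fin m → Space d =>
        K s (Fin.insertNth (α := fun _ => Space d) i y (fun j => z j + y))) q volume

/-- The single-scale properties: `K_s` is supported where `|x_k - x_l| ≤ 2^s` for all `k`, `l`,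
and `[K]_q < ∞`. -/
structure IsSingleScale {d m : ℕ} (K : Kernels d m) (q : ℝ≥0∞) : Prop where
  measurable : ∀ s, Measurable (K s)
  support : ∀ s x, K s x ≠ 0 → ∀ k l, ‖x k - x l‖ ≤ (2 : ℝ) ^ s
  size : kernelSize K q < ∞

/-- The `(m+1)`-linear form with kernel `∑_{s ∈ A} K_s`, for a finite set `A` of scales. -/
def form {d m : ℕ} (K : Kernels d m) (A : Finset ℤ) (f : Fin (m + 1) → Space d → ℂ) : ℂ :=
  ∫ x : Fin (m + 1) → Space d, (∑ s ∈ A, K s x) * ∏ i, f i (x i)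

/-- The truncated form `Λ_μ^ν`, containing the scales `μ < s < ν`. -/
def truncForm {d m : ℕ} (K : Kernels d m) (μ ν : ℤ) (f : Fin (m + 1) → Space d → ℂ) : ℂ :=
  form K (Finset.Ioo μ ν) f

open Classical in
/-- The localized form `Λ_L(f_1, …, f_{m+1}) = Λ^{s_L}(f_1 1_L, f_2, …, f_{m+1})`, containing only
those scales of the truncation that are at most `s_L`. -/
def localForm {d m : ℕ} (K : Kernels d m) (μ ν : ℤ) (L : Cube d)
    (f : Fin (m + 1) → Space d → ℂ) : ℂ :=
  form K ((Finset.Ioo μ ν).filter fun s : ℤ => (s : ℝ) ≤ L.scale)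
    (Function.update f 0 (L.carrier.indicator (f 0)))

/-- The form `Λ_P = Λ_Q - ∑_{L ∈ P, L ⊆ Q} Λ_L` of a stopping collection `P` with top `Q`. Only
the finitely many `L` with `s_L > μ` contribute to the sum. -/
def stoppingForm {d m : ℕ} (K : Kernels d m) (μ ν : ℤ) (P : Set (Cube d)) (Q : Cube d)
    (f : Fin (m + 1) → Space d → ℂ) : ℂ :=
  localForm K μ ν Q f -
    ∑' L : {L : Cube d // L ∈ P ∧ L.carrier ⊆ Q.carrier}, localForm K μ ν L f

/-- The uniform truncation bound `C_T`: the supremum over all finite truncations of the norm of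
`Λ_μ^ν` as a form on `L^{ρ_1} × … × L^{ρ_{m+1}}`. -/
def truncationBound {d m : ℕ} (K : Kernels d m) (ρ : Fin (m + 1) → ℝ≥0∞) : ℝ≥0∞ :=
  ⨆ (μ : ℤ) (ν : ℤ) (f : Fin (m + 1) → Space d → ℂ)
    (_ : ∀ i, MemLp (f i) (ρ i) volume ∧ eLpNorm (f i) (ρ i) volume ≤ 1), ‖truncForm K μ ν f‖ₑ

/-- The exponents in the `n`-th bad-function estimate: `∞` before position `n`, and `p_j` from
position `n` on. -/
def slotExponent {m : ℕ} (p : Fin (m + 1) → ℝ≥0∞) (n j : Fin (m + 1)) : ℝ≥0∞ :=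
  if j < n then ∞ else p j

/-- The `m + 1` bad-function estimates with constant `C`, uniformly over all finite truncations,
dyadic lattices and stopping collections. In the `n`-th estimate the `n`-th function is the bad
function `b ∈ 𝒳̇_{p_n}`, the functions before it are in `𝒴_∞` and those after it in `𝒴_{p_j}`;
only tuples for which the integrals defining the forms converge absolutely are tested. -/
def BadFunctionEstimates {d m : ℕ} (K : Kernels d m) (p : Fin (m + 1) → ℝ≥0∞) (C : ℝ≥0) : Prop :=
  ∀ (μ ν : ℤ) (D P : Set (Cube d)) (Q : Cube d),
    IsDyadicLattice D → IsStoppingCollection D P Q →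
    ∀ (n : Fin (m + 1)) (h : Fin (m + 1) → Space d → ℂ),
      (∀ j, MemY P Q (slotExponent p n j) (h j)) →
      IsMeanZeroOn P (h n) →
      (∀ s ∈ Finset.Ioo μ ν, Integrable
        (fun x : Fin (m + 1) → Space d => K s x * ∏ i, h i (x i)) volume) →
      ‖stoppingForm K μ ν P Q h‖ₑ ≤
        C * volume Q.carrier * ∏ j, yNorm P (slotExponent p n j) (h j)

end SparseForm

end

open SparseForm

open MeasureTheory Set
open scoped ENNReal NNReal

namespace SparseForm

/-! ### Geometry and volume of cubes -/

namespace Cube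

variable {d : ℕ}

/-! The core is a stopping-time recursion for bounded functions of bounded support. Such a tuple
sees a truncated form as the localized form of one large dyadic cube `Q`
(`exists_truncForm_eq_localForm`), and by the support of the kernels that form only depends on the
functions inside `3Q` (`localForm_congr`).

Let `E` be the open set where some average of some `h i = f i 1_{3Q}` exceeds a large multiple of
its average over `3Q`. The weak-type bound `volume_average_gt_le`, a consequence of Vitali's lemma,
makes `E` small. The maximal dyadic cubes `L ⊆ 3Q` with `9L ⊆ E` form a stopping collection `P` of
total volume at most `|Q|/2`, on which every `h i` is controlled by its average over `3Q`
(`exists_stoppingCollection`). Then `Λ_Q(f) = Λ_P(h) + ∑ Λ_L(f)`, the sum being over the `L ∈ P`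
inside `Q`.

For `Λ_P(h)`, write `h i = g i + b i` with `g i` bounded and `b i` of mean zero on the cubes of `P`,
and replace `h i` by `g i` one slot at a time. The `m + 1` differences fall under the bad-function
estimates; the remaining `Λ_P(g)` is bounded through `C_T`, since all its arguments are bounded
(`enorm_stoppingForm_le`). The terms `Λ_L(f)` are treated recursively. Scales drop at each
generation and forms of scale at most `μ` vanish, so the recursion is finite; the sets `Q \ ⋃ L` are
disjoint and carry half the volume (`exists_sparse_family`).

This yields a constant depending on `d` and `m`, whereas `c` may only depend on `d`. The dependence
is moved into the sparsity constant: replacing each cube by `M` distinct slightly larger ones, and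
cutting its disjoint set into `M` pieces, multiplies the sparse form by about `M`
(`nat_mul_sum_le_iSup_PSF`). With `M` large this absorbs every constant, so `c = 1` works. General
`f` follow by cutting off in height and dominated convergence (`tendsto_truncForm_cutoff`). -/

theorem eq_of_corner_side {Q R : Cube d} (hc : ∀ i, Q.corner i = R.corner i)
    (hs : Q.side = R.side) : Q = R := by
  cases Q; cases R
  simp only [Cube.mk.injEq]
  exact ⟨PiLp.ext hc, hs⟩

/-- The cube whose carrier is the concentric dilate `t Q`. -/
noncomputable def dil (t : ℝ) (ht : 0 < t) (Q : Cube d) : Cube d :=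
  ⟨WithLp.toLp 2 fun i => Q.corner i - (t - 1) / 2 * Q.side, t * Q.side, mul_pos ht Q.side_pos⟩

theorem carrier_dil (t : ℝ) (ht : 0 < t) (Q : Cube d) : (Q.dil t ht).carrier = Q.dilate t := by
  ext x
  simp only [carrier, dilate, dil, mem_ofPred_eq]
  refine forall_congr' fun i => ?_
  rw [show Q.corner i - (t - 1) / 2 * Q.side + t * Q.side
    = Q.corner i + (t + 1) / 2 * Q.side by ring]

theorem side_dil (t : ℝ) (ht : 0 < t) (Q : Cube d) : (Q.dil t ht).side = t * Q.side := rfl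

theorem carrier_eq_preimage (Q : Cube d) :
    Q.carrier = (MeasurableEquiv.toLp 2 (Fin d → ℝ)).symm ⁻¹'
      (univ.pi fun i => Ico (Q.corner i) (Q.corner i + Q.side)) := by
  ext x
  simp [carrier]

theorem measurableSet_carrier (Q : Cube d) : MeasurableSet Q.carrier := by
  rw [carrier_eq_preimage]
  exact (MeasurableEquiv.measurable _) (MeasurableSet.univ_pi fun i => measurableSet_Ico)

theorem volume_carrier (Q : Cube d) : volume Q.carrier = ENNReal.ofReal Q.side ^ d := by
  rw [carrier_eq_preimage,
    (EuclideanSpace.volume_preserving_symm_measurableEquiv_toLp (Fin d)).measure_preimage_equiv,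
    Real.volume_pi_Ico]
  simp

theorem volume_carrier_pos (Q : Cube d) : 0 < volume Q.carrier := by
  rw [volume_carrier]
  exact ENNReal.pow_pos (ENNReal.ofReal_pos.2 Q.side_pos) _

theorem volume_carrier_ne_zero (Q : Cube d) : volume Q.carrier ≠ 0 := Q.volume_carrier_pos.ne'

theorem volume_carrier_ne_top (Q : Cube d) : volume Q.carrier ≠ ∞ := by
  rw [volume_carrier]
  exact ENNReal.pow_ne_top ENNReal.ofReal_ne_top

theorem volume_dil (t : ℝ) (ht : 0 < t) (Q : Cube d) :
    volume (Q.dil t ht).carrier = ENNReal.ofReal t ^ d * volume Q.carrier := by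
  rw [volume_carrier, volume_carrier, side_dil, ENNReal.ofReal_mul ht.le, mul_pow]

theorem volume_dilate (t : ℝ) (ht : 0 < t) (Q : Cube d) :
    volume (Q.dilate t) = ENNReal.ofReal t ^ d * volume Q.carrier := by
  rw [← carrier_dil t ht, volume_dil]

theorem corner_mem (Q : Cube d) : Q.corner ∈ Q.carrier :=
  fun _ => ⟨le_rfl, by linarith [Q.side_pos]⟩

theorem carrier_nonempty (Q : Cube d) : Q.carrier.Nonempty := ⟨_, Q.corner_mem⟩

/-- The open cube. -/
def inner (Q : Cube d) : Set (Space d) :=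
  {x | ∀ i, Q.corner i < x i ∧ x i < Q.corner i + Q.side}

theorem isOpen_inner (Q : Cube d) : IsOpen Q.inner := by
  have : Q.inner = ⋂ i, {x : Space d | Q.corner i < x i ∧ x i < Q.corner i + Q.side} := by
    ext x; simp [inner]
  rw [this]
  refine isOpen_iInter_of_finite fun i => ?_
  have hc : Continuous fun x : Space d => x i := by fun_prop
  exact (isOpen_lt continuous_const hc).inter (isOpen_lt hc continuous_const)

theorem inner_subset (Q : Cube d) : Q.inner ⊆ Q.carrier := fun _ hx i => ⟨(hx i).1.le, (hx i).2⟩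

/-- Doubling allows the exceptional set to be a union of open cubes, hence open, at the cost of a
factor `2 ^ d` in the averages. -/
theorem carrier_subset_inner_dil (Q : Cube d) : Q.carrier ⊆ (Q.dil 2 two_pos).inner := by
  intro x hx i
  have := hx i
  have := Q.side_pos
  simp only [dil]
  constructor <;> linarith

theorem nonempty_inner (Q : Cube d) : Q.inner.Nonempty :=
  ⟨WithLp.toLp 2 fun i => Q.corner i + Q.side / 2, fun i => by
    have := Q.side_pos
    constructor <;> simp <;> linarith⟩

theorem isBounded_carrier (Q : Cube d) : Bornology.IsBounded Q.carrier := by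
  have hK : IsCompact {x : Fin d → ℝ | ∀ i, x i ∈ Icc (Q.corner i) (Q.corner i + Q.side)} :=
    isCompact_pi_infinite fun i => isCompact_Icc
  have := (hK.image (PiLp.continuous_toLp 2 (fun _ : Fin d => ℝ))).isBounded
  refine this.subset fun x hx => ⟨WithLp.ofLp x, fun i => ⟨(hx i).1, (hx i).2.le⟩, rfl⟩

/-- A cube of side `4r` containing the ball of radius `r` about `x`. -/
noncomputable def centered (x : Space d) (r : ℝ) (hr : 0 < r) : Cube d :=
  ⟨WithLp.toLp 2 fun i => x i - r, 4 * r, by positivity⟩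

theorem closedBall_subset_centered (x : Space d) (r : ℝ) (hr : 0 < r) :
    Metric.closedBall x r ⊆ (centered x r hr).carrier := by
  intro y hy i
  have h1 : |y i - x i| ≤ r := by
    have := PiLp.norm_apply_le (y - x) i
    rw [Real.norm_eq_abs] at this
    exact this.trans (by simpa [dist_eq_norm] using hy)
  have := abs_le.1 h1
  simp only [centered]
  constructor <;> linarith

/-- In each coordinate `Q` reaches at most `Q.side ≤ 2 * R.side` away from a common point, and `5R`
extends `R` by `2 * R.side` on either side. -/
theorem dilate_disjoint_or_subset {Q R : Cube d} (h : (Q.carrier ∩ R.carrier).Nonempty)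
    (hs : Q.side ≤ 2 * R.side) : Q.carrier ⊆ R.dilate 5 := by
  obtain ⟨y, hQ, hR⟩ := h
  intro x hx i
  have := hQ i
  have := hR i
  have := hx i
  constructor <;> linarith

end Cube

/-! ### Vitali covering -/

variable {d : ℕ}

/-- The Vitali covering lemma for cubes on which a finite measure dominates the volume. -/
theorem volume_biUnion_le (hd : 1 ≤ d) (ν : Measure (Space d)) (hν : ν univ ≠ ∞)
    (T : Set (Cube d)) (hT : ∀ R ∈ T, volume R.carrier ≤ ν R.carrier) :
    volume (⋃ R ∈ T, R.carrier) ≤ 5 ^ d * ν univ := by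
  -- Vitali's lemma needs bounded sides. As `d ≥ 1`, a side longer than `1` is at most the volume of
  -- its cube, hence at most the total mass of `ν`.
  have hb : ∀ R ∈ T, R.side ≤ max 1 (ν univ).toReal := by
    intro R hR
    rcases le_total R.side 1 with h | h
    · exact h.trans (le_max_left _ _)
    · refine le_trans ?_ (le_max_right _ _)
      refine (le_self_pow₀ h (by omega : d ≠ 0)).trans ?_
      have := (hT R hR).trans (measure_mono (subset_univ _))
      rw [Cube.volume_carrier, ← ENNReal.ofReal_pow R.side_pos.le] at this
      exact (ENNReal.ofReal_le_iff_le_toReal hν).1 this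
  obtain ⟨u, hu, hdis, hcov⟩ := Vitali.exists_disjoint_subfamily_covering_enlargement
    Cube.carrier T Cube.side 2 one_lt_two (fun R _ => R.side_pos.le) _ hb
    (fun R _ => R.carrier_nonempty)
  have hcount : u.Countable := by
    refine PairwiseDisjoint.countable_of_isOpen (s := Cube.inner) ?_ (fun R _ => R.isOpen_inner)
      (fun R _ => R.nonempty_inner)
    exact hdis.mono fun R => R.inner_subset
  have hsub : (⋃ R ∈ T, R.carrier) ⊆ ⋃ R ∈ u, R.dilate 5 := by
    refine iUnion₂_subset fun R hR => ?_
    obtain ⟨b, hb, hne, hs⟩ := hcov R hR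
    exact (Cube.dilate_disjoint_or_subset hne hs).trans (subset_biUnion_of_mem (u := fun R => R.dilate 5) hb)
  calc volume (⋃ R ∈ T, R.carrier) ≤ volume (⋃ R ∈ u, R.dilate 5) := measure_mono hsub
    _ ≤ ∑' R : u, volume ((R : Cube d).dilate 5) := measure_biUnion_le _ hcount _
    _ ≤ ∑' R : u, 5 ^ d * ν (R : Cube d).carrier := by
        refine ENNReal.tsum_le_tsum fun R => ?_
        rw [Cube.volume_dilate 5 (by norm_num)]
        simp only [ENNReal.ofReal_ofNat]
        exact mul_le_mul_right (hT _ (hu R.2)) _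
    _ = 5 ^ d * ν (⋃ R ∈ u, R.carrier) := by
        rw [ENNReal.tsum_mul_left, measure_biUnion hcount hdis
          (fun R _ => R.measurableSet_carrier)]
    _ ≤ 5 ^ d * ν univ := by gcongr; exact subset_univ _

/-! ### Averages -/

theorem average_top (f : Space d → ℂ) (Q : Cube d) :
    average f ∞ Q = eLpNorm (Q.carrier.indicator f) ∞ volume := by
  simp [average]

theorem eLpNorm_indicator_carrier_le {p : ℝ≥0∞} (f : Space d → ℂ) (Q : Cube d) :
    eLpNorm (Q.carrier.indicator f) p volume
      ≤ eLpNorm f ∞ volume * volume Q.carrier ^ (p⁻¹).toReal := by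
  rw [eLpNorm_indicator_eq_eLpNorm_restrict Q.measurableSet_carrier]
  by_cases htop : eLpNorm f ∞ volume = ∞
  · rw [htop, ENNReal.top_mul]
    · exact le_top
    · exact (ENNReal.rpow_pos Q.volume_carrier_pos Q.volume_carrier_ne_top).ne'
  have hae : ∀ᵐ x ∂(volume.restrict Q.carrier), ‖f x‖ ≤ (eLpNorm f ∞ volume).toReal := by
    refine ae_restrict_of_ae ?_
    rw [eLpNorm_exponent_top] at htop ⊢
    filter_upwards [ae_le_eLpNormEssSup (f := f) (μ := volume)] with x hx
    rw [← toReal_enorm]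
    exact ENNReal.toReal_mono htop hx
  refine (eLpNorm_le_of_ae_bound hae).trans ?_
  rw [ENNReal.ofReal_toReal htop, Measure.restrict_apply_univ, mul_comm, ENNReal.toReal_inv]

theorem average_le_eLpNorm_top {p : ℝ≥0∞} (f : Space d → ℂ)
    (Q : Cube d) : average f p Q ≤ eLpNorm f ∞ volume := by
  calc average f p Q ≤ volume Q.carrier ^ (-(p⁻¹).toReal) *
        (eLpNorm f ∞ volume * volume Q.carrier ^ (p⁻¹).toReal) := by
        unfold average; gcongr; exact eLpNorm_indicator_carrier_le f Q
    _ = eLpNorm f ∞ volume * (volume Q.carrier ^ (-(p⁻¹).toReal)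
          * volume Q.carrier ^ (p⁻¹).toReal) := by ring
    _ = eLpNorm f ∞ volume := by
        rw [← ENNReal.rpow_add _ _ Q.volume_carrier_ne_zero Q.volume_carrier_ne_top]
        simp

theorem average_add_le {p : ℝ≥0∞} (hp : 1 ≤ p) {f g : Space d → ℂ}
    (hf : AEStronglyMeasurable f volume) (hg : AEStronglyMeasurable g volume) (Q : Cube d) :
    average (f + g) p Q ≤ average f p Q + average g p Q := by
  unfold average
  rw [← mul_add, Set.indicator_add']
  gcongr
  exact eLpNorm_add_le (hf.indicator Q.measurableSet_carrier)
    (hg.indicator Q.measurableSet_carrier) hp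

theorem average_mono_norm {p : ℝ≥0∞} {f g : Space d → ℂ} (h : ∀ x, ‖f x‖ ≤ ‖g x‖) (Q : Cube d) :
    average f p Q ≤ average g p Q := by
  unfold average
  gcongr
  refine eLpNorm_mono fun x => ?_
  by_cases hx : x ∈ Q.carrier <;> simp [hx, h]

/-- The normalizing factors differ by at most `K ^ (1/p)`, and `1/p ≤ 1 ≤ K` bounds this by `K` for
all exponents at once, `p = ∞` included. -/
theorem average_mono_cube {p : ℝ≥0∞} (hp : 1 ≤ p) (f : Space d → ℂ) {Q R : Cube d}
    (hQR : Q.carrier ⊆ R.carrier) {K : ℝ≥0∞} (hK : 1 ≤ K)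
    (hv : volume R.carrier ≤ K * volume Q.carrier) :
    average f p Q ≤ K * average f p R := by
  unfold average
  rw [← mul_assoc]
  have he : (p⁻¹).toReal ≤ 1 := by
    have : p⁻¹ ≤ 1 := ENNReal.inv_le_one.2 hp
    simpa using ENNReal.toReal_mono ENNReal.one_ne_top this
  have he0 : 0 ≤ (p⁻¹).toReal := ENNReal.toReal_nonneg
  gcongr ?_ * ?_
  · rw [ENNReal.rpow_neg, ENNReal.rpow_neg]
    rw [← div_eq_mul_inv, ENNReal.le_div_iff_mul_le
      (Or.inl (ENNReal.rpow_pos R.volume_carrier_pos R.volume_carrier_ne_top).ne')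
      (Or.inl (ENNReal.rpow_ne_top_of_nonneg he0 R.volume_carrier_ne_top)), mul_comm,
      ← div_eq_mul_inv, ENNReal.div_le_iff_le_mul
      (Or.inl (ENNReal.rpow_pos Q.volume_carrier_pos Q.volume_carrier_ne_top).ne')
      (Or.inl (ENNReal.rpow_ne_top_of_nonneg he0 Q.volume_carrier_ne_top))]
    calc volume R.carrier ^ (p⁻¹).toReal ≤ (K * volume Q.carrier) ^ (p⁻¹).toReal := by gcongr
      _ = K ^ (p⁻¹).toReal * volume Q.carrier ^ (p⁻¹).toReal :=
          ENNReal.mul_rpow_of_nonneg _ _ he0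
      _ ≤ K ^ (1 : ℝ) * volume Q.carrier ^ (p⁻¹).toReal := by
          gcongr
      _ = _ := by rw [ENNReal.rpow_one]
  · refine eLpNorm_mono fun x => ?_
    by_cases hx : x ∈ Q.carrier
    · simp [hx, hQR hx]
    · simp [hx]

theorem average_one_le {p : ℝ≥0∞} (hp : 1 ≤ p) {f : Space d → ℂ}
    (hf : AEStronglyMeasurable f volume) (Q : Cube d) : average f 1 Q ≤ average f p Q := by
  unfold average
  rw [eLpNorm_indicator_eq_eLpNorm_restrict Q.measurableSet_carrier,
    eLpNorm_indicator_eq_eLpNorm_restrict Q.measurableSet_carrier]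
  have := eLpNorm_le_eLpNorm_mul_rpow_measure_univ hp
    (hf.mono_measure (Measure.restrict_le_self (s := Q.carrier)))
  rw [Measure.restrict_apply_univ] at this
  calc _ ≤ volume Q.carrier ^ (-((1 : ℝ≥0∞)⁻¹).toReal) * (eLpNorm f p (volume.restrict Q.carrier)
        * volume Q.carrier ^ (1 / (1 : ℝ≥0∞).toReal - 1 / p.toReal)) := by gcongr
    _ = eLpNorm f p (volume.restrict Q.carrier) * (volume Q.carrier ^ (-((1 : ℝ≥0∞)⁻¹).toReal) *
        volume Q.carrier ^ (1 / (1 : ℝ≥0∞).toReal - 1 / p.toReal)) := by ring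
    _ = _ := by
      rw [← ENNReal.rpow_add _ _ Q.volume_carrier_ne_zero Q.volume_carrier_ne_top, mul_comm]
      congr 2
      simp only [inv_one, ENNReal.toReal_one, one_div, ENNReal.toReal_inv]
      ring

theorem average_one_eq (f : Space d → ℂ) (Q : Cube d) :
    average f 1 Q = (volume Q.carrier)⁻¹ * ∫⁻ x in Q.carrier, ‖f x‖ₑ := by
  unfold average
  rw [eLpNorm_indicator_eq_eLpNorm_restrict Q.measurableSet_carrier,
    eLpNorm_one_eq_lintegral_enorm]
  simp [ENNReal.rpow_neg]

theorem average_rpow {p : ℝ≥0∞} (hp : 1 ≤ p) (hpt : p ≠ ∞) (f : Space d → ℂ) (Q : Cube d) :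
    average f p Q ^ p.toReal = (volume Q.carrier)⁻¹ * ∫⁻ x in Q.carrier, ‖f x‖ₑ ^ p.toReal := by
  have hp0 : p ≠ 0 := (zero_lt_one.trans_le hp).ne'
  have hr : 0 < p.toReal := ENNReal.toReal_pos hp0 hpt
  unfold average
  rw [ENNReal.mul_rpow_of_nonneg _ _ hr.le, ← ENNReal.rpow_mul, ENNReal.toReal_inv,
    eLpNorm_indicator_eq_eLpNorm_restrict Q.measurableSet_carrier,
    eLpNorm_eq_lintegral_rpow_enorm_toReal hp0 hpt, ← ENNReal.rpow_mul]
  rw [show -p.toReal⁻¹ * p.toReal = -1 by field_simp, one_div_mul_cancel hr.ne',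
    ENNReal.rpow_one, ENNReal.rpow_neg_one]

theorem average_ne_top {p : ℝ≥0∞} {f : Space d → ℂ} {M : ℝ} (hM : ∀ x, ‖f x‖ ≤ M) (Q : Cube d) :
    average f p Q ≠ ∞ := by
  refine ne_top_of_le_ne_top ?_ ((average_le_eLpNorm_top f Q).trans
    (eLpNorm_le_of_ae_bound (C := M) (.of_forall hM)))
  simp

theorem average_eq_zero {p : ℝ≥0∞} (hp : 1 ≤ p) {f : Space d → ℂ}
    (hf : AEStronglyMeasurable f volume) {Q : Cube d} (h : average f p Q = 0) :
    Q.carrier.indicator f =ᵐ[volume] 0 := by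
  unfold average at h
  rcases mul_eq_zero.1 h with h | h
  · exact absurd h (ENNReal.rpow_pos Q.volume_carrier_pos Q.volume_carrier_ne_top).ne'
  · exact (eLpNorm_eq_zero_iff (hf.indicator Q.measurableSet_carrier)
      (zero_lt_one.trans_le hp).ne').1 h

/-- The weak-type bound for the maximal function of a function supported in `Q`, normalized by the
average over `Q`. -/
theorem volume_average_gt_le (hd : 1 ≤ d) {p : ℝ≥0∞} (hp : 1 ≤ p) {h : Space d → ℂ} {Q : Cube d}
    (hsupp : Function.support h ⊆ Q.carrier) (ha0 : average h p Q ≠ 0) (hat : average h p Q ≠ ∞)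
    {C : ℝ≥0∞} (hC : 1 ≤ C) (hCt : C ≠ ∞) :
    volume (⋃ R ∈ {R : Cube d | C * average h p Q < average h p R}, R.carrier)
      ≤ 5 ^ d * (volume Q.carrier / C) := by
  have hC0 : C ≠ 0 := (zero_lt_one.trans_le hC).ne'
  have hind : Q.carrier.indicator h = h := Set.indicator_eq_self.2 hsupp
  -- For `p = ∞` no cube is exceptional: `h` lives on `Q`, so its average over `Q` is already its
  -- supremum.
  by_cases hpt : p = ∞
  · subst hpt
    have : {R : Cube d | C * average h ∞ Q < average h ∞ R} = ∅ := by
      ext R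
      simp only [mem_ofPred_eq, mem_empty_iff_false, iff_false, not_lt]
      refine (average_le_eLpNorm_top h R).trans ?_
      rw [average_top, hind]
      exact le_mul_of_one_le_left (by positivity) hC
    simp [this]
  have hp0 : p ≠ 0 := (zero_lt_one.trans_le hp).ne'
  have hr : 0 < p.toReal := ENNReal.toReal_pos hp0 hpt
  have hr1 : 1 ≤ p.toReal := by
    simpa using ENNReal.toReal_mono hpt hp
  set F : ℝ≥0∞ := ∫⁻ x, ‖h x‖ₑ ^ p.toReal with hF
  have hFQ : ∫⁻ x in Q.carrier, ‖h x‖ₑ ^ p.toReal = F := by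
    rw [hF, ← lintegral_indicator Q.measurableSet_carrier]
    refine lintegral_congr fun x => ?_
    by_cases hx : x ∈ Q.carrier
    · simp [hx]
    · have : h x = 0 := by
        by_contra hne; exact hx (hsupp hne)
      simp [hx, this, hr]
  have hQ : average h p Q ^ p.toReal = (volume Q.carrier)⁻¹ * F := by
    rw [average_rpow hp hpt, hFQ]
  have hF0 : F ≠ 0 := by
    intro h0
    rw [h0, mul_zero] at hQ
    exact ha0 ((ENNReal.rpow_eq_zero_iff_of_pos hr).1 hQ)
  have hFt : F ≠ ∞ := by
    intro h0
    rw [h0, ENNReal.mul_top (ENNReal.inv_ne_zero.2 Q.volume_carrier_ne_top)] at hQ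
    exact hat ((ENNReal.rpow_eq_top_iff_of_pos hr).1 hQ)
  -- The density `|h|^p` scaled to total mass `|Q| / C`; with this scaling every exceptional cube
  -- `R` satisfies `|R| ≤ ν R`.
  set ν : Measure (Space d) := (volume Q.carrier / (C * F)) •
    (volume.withDensity fun x => ‖h x‖ₑ ^ p.toReal) with hνdef
  have hCF : C * F ≠ 0 := mul_ne_zero hC0 hF0
  have hCFt : C * F ≠ ∞ := ENNReal.mul_ne_top hCt hFt
  have hν : ν univ = volume Q.carrier / C := by
    rw [hνdef, Measure.smul_apply, withDensity_apply _ MeasurableSet.univ, Measure.restrict_univ,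
      ← hF, smul_eq_mul, ENNReal.div_eq_inv_mul, ENNReal.mul_inv (Or.inl hC0) (Or.inl hCt)]
    rw [show C⁻¹ * F⁻¹ * volume Q.carrier * F = C⁻¹ * volume Q.carrier * (F⁻¹ * F) by ring,
      ENNReal.inv_mul_cancel hF0 hFt, mul_one, ENNReal.div_eq_inv_mul]
  rw [← hν]
  refine volume_biUnion_le hd ν ?_ _ fun R hR => ?_
  · rw [hν]
    exact (ENNReal.div_lt_top Q.volume_carrier_ne_top hC0).ne
  · have h1 : C * ((volume Q.carrier)⁻¹ * F) ≤
        (volume R.carrier)⁻¹ * ∫⁻ x in R.carrier, ‖h x‖ₑ ^ p.toReal := by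
      rw [← average_rpow hp hpt, ← hQ]
      -- Giving up `C ^ p` for `C` keeps the bound independent of `p`.
      calc C * average h p Q ^ p.toReal ≤ C ^ p.toReal * average h p Q ^ p.toReal := by
            gcongr
            simpa using ENNReal.rpow_le_rpow_of_exponent_le hC hr1
        _ = (C * average h p Q) ^ p.toReal := (ENNReal.mul_rpow_of_nonneg _ _ hr.le).symm
        _ ≤ average h p R ^ p.toReal := ENNReal.rpow_le_rpow (le_of_lt hR) hr.le
    rw [hνdef, Measure.smul_apply, withDensity_apply _ R.measurableSet_carrier, smul_eq_mul]
    set I := ∫⁻ x in R.carrier, ‖h x‖ₑ ^ p.toReal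
    set q := volume Q.carrier with hq
    set v := volume R.carrier with hv
    have hv0 : v ≠ 0 := R.volume_carrier_ne_zero
    have hvt : v ≠ ∞ := R.volume_carrier_ne_top
    have hq0 : q ≠ 0 := Q.volume_carrier_ne_zero
    have hqt : q ≠ ∞ := Q.volume_carrier_ne_top
    calc v = v * (q / (C * F)) * (C * (q⁻¹ * F)) := by
          rw [div_eq_mul_inv]
          rw [show v * (q * (C * F)⁻¹) * (C * (q⁻¹ * F)) = v * (q * q⁻¹) * ((C * F)⁻¹ * (C * F)) by
            ring, ENNReal.mul_inv_cancel hq0 hqt, ENNReal.inv_mul_cancel hCF hCFt]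
          simp
      _ ≤ v * (q / (C * F)) * (v⁻¹ * I) := by gcongr
      _ = (v * v⁻¹) * ((q / (C * F)) * I) := by ring
      _ = _ := by rw [ENNReal.mul_inv_cancel hv0 hvt, one_mul]

/-- Almost everywhere, a locally integrable function is bounded by its averages over cubes. -/
theorem ae_enorm_le_of_average_le (d : ℕ) : ∃ B : ℝ≥0, 1 ≤ B ∧ ∀ h : Space d → ℂ,
    LocallyIntegrable h volume → ∀ᵐ x, ∀ t : ℝ≥0∞,
      (∀ R : Cube d, x ∈ R.carrier → average h 1 R ≤ t) → ‖h x‖ₑ ≤ B * t := by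
  set ω := volume (Metric.ball (0 : Space d) 1) with hω
  have hω0 : ω ≠ 0 := (Metric.measure_ball_pos _ _ one_pos).ne'
  have hωt : ω ≠ ∞ := measure_ball_lt_top.ne
  have hBt : 4 ^ d / ω ≠ ∞ := (ENNReal.div_lt_top (by finiteness) hω0).ne
  -- `4 ^ d / ω` is the volume ratio of a cube of side `4r` to a ball of radius `r`. It turns
  -- Lebesgue differentiation along balls into a bound by averages over cubes.
  refine ⟨max 1 (4 ^ d / ω).toNNReal, le_max_left _ _, fun h hint => ?_⟩
  filter_upwards [IsUnifLocDoublingMeasure.ae_tendsto_average volume hint 1] with x hx t ht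
  have hlim := (hx (l := nhdsWithin (0 : ℝ) (Ioi 0)) (fun _ => x) id Filter.tendsto_id
    (by
      filter_upwards [self_mem_nhdsWithin] with r hr
      exact Metric.mem_closedBall_self (by simpa using le_of_lt hr))).enorm
  refine le_of_tendsto hlim ?_
  filter_upwards [self_mem_nhdsWithin] with r hr
  have hr : 0 < r := hr
  have hball : volume (Metric.closedBall x r) = ENNReal.ofReal r ^ d * ω := by
    rw [Measure.addHaar_closedBall _ _ hr.le, ENNReal.ofReal_pow hr.le]
    simp [hω]
  have hr0 : ENNReal.ofReal r ^ d ≠ 0 := (ENNReal.pow_pos (ENNReal.ofReal_pos.2 hr) _).ne'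
  have hrt : ENNReal.ofReal r ^ d ≠ ∞ := by finiteness
  have hcube : volume (Cube.centered x r hr).carrier = 4 ^ d * ENNReal.ofReal r ^ d := by
    rw [Cube.volume_carrier, Cube.centered, ENNReal.ofReal_mul (by norm_num), mul_pow]
    simp
  calc ‖⨍ y in Metric.closedBall x r, h y‖ₑ
      ≤ (volume (Metric.closedBall x r))⁻¹ * ∫⁻ y in Metric.closedBall x r, ‖h y‖ₑ := by
        rw [average_eq, enorm_smul]
        gcongr
        · rw [measureReal_restrict_apply_univ, measureReal_def, ← ENNReal.toReal_inv,
            Real.enorm_of_nonneg ENNReal.toReal_nonneg]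
          exact ENNReal.ofReal_toReal_le
        · exact enorm_integral_le_lintegral_enorm _
    _ ≤ (volume (Metric.closedBall x r))⁻¹ *
          ∫⁻ y in (Cube.centered x r hr).carrier, ‖h y‖ₑ := by
        gcongr
        exact Cube.closedBall_subset_centered x r hr
    _ = 4 ^ d / ω * average h 1 (Cube.centered x r hr) := by
        rw [average_one_eq, hball, hcube, ENNReal.mul_inv (Or.inl hr0) (Or.inl hrt),
          ENNReal.mul_inv (Or.inl (by positivity)) (Or.inl (by finiteness)), div_eq_mul_inv]
        have h4 : (4 : ℝ≥0∞) ^ d * (4 ^ d)⁻¹ = 1 :=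
          ENNReal.mul_inv_cancel (by positivity) (by finiteness)
        set I := ∫⁻ y in (Cube.centered x r hr).carrier, ‖h y‖ₑ
        calc _ = (ENNReal.ofReal r ^ d)⁻¹ * ω⁻¹ * I * 1 := by ring
          _ = _ := by rw [← h4]; ring
    _ ≤ 4 ^ d / ω * t := by
        gcongr
        exact ht _ (Cube.closedBall_subset_centered x r hr (Metric.mem_closedBall_self hr.le))
    _ ≤ _ := by
        gcongr
        rw [ENNReal.coe_max, ENNReal.coe_toNNReal hBt]
        exact le_max_right _ _

/-! ### Translated standard dyadic lattices -/

/-- The dyadic cube of scale `k` and index `n` in the standard lattice translated by `v`. -/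
noncomputable def dyadicCube (v : Space d) (k : ℤ) (n : Fin d → ℤ) : Cube d :=
  ⟨WithLp.toLp 2 fun i => v i + (2 : ℝ) ^ k * n i, (2 : ℝ) ^ k, by positivity⟩

/-- The standard dyadic lattice translated by `v`. -/
def dyadicLattice (v : Space d) : Set (Cube d) :=
  {Q | ∃ (k : ℤ) (n : Fin d → ℤ), Q.side = (2 : ℝ) ^ k ∧
    ∀ i, Q.corner i = v i + (2 : ℝ) ^ k * n i}

theorem isDyadicLattice_dyadicLattice (v : Space d) : IsDyadicLattice (dyadicLattice v) :=
  ⟨fun _ => v, fun _ => ⟨0, by simp⟩, rfl⟩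

theorem dyadicCube_mem (v : Space d) (k : ℤ) (n : Fin d → ℤ) :
    dyadicCube v k n ∈ dyadicLattice v := ⟨k, n, rfl, fun _ => rfl⟩

/-- The index of the dyadic cube of scale `k` containing `x`. -/
noncomputable def cell (v : Space d) (k : ℤ) (x : Space d) (i : Fin d) : ℤ :=
  ⌊(x i - v i) / (2 : ℝ) ^ k⌋

/-- The dyadic cube of scale `k` containing `x`. -/
noncomputable def dyadicAt (v : Space d) (k : ℤ) (x : Space d) : Cube d :=
  dyadicCube v k (cell v k x)

theorem side_dyadicAt (v : Space d) (k : ℤ) (x : Space d) :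
    (dyadicAt v k x).side = (2 : ℝ) ^ k := rfl

theorem mem_dyadicCube {v : Space d} {k : ℤ} {n : Fin d → ℤ} {x : Space d} :
    x ∈ (dyadicCube v k n).carrier ↔ ∀ i, cell v k x i = n i := by
  have hk : (0 : ℝ) < 2 ^ k := by positivity
  simp only [Cube.carrier, dyadicCube, mem_ofPred_eq, cell, Int.floor_eq_iff]
  refine forall_congr' fun i => ?_
  rw [le_div_iff₀ hk, div_lt_iff₀ hk]
  constructor <;> rintro ⟨h1, h2⟩ <;> constructor <;> nlinarith

theorem mem_dilate_three_dyadicCube {v : Space d} {k : ℤ} {n : Fin d → ℤ} {x : Space d} :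
    x ∈ (dyadicCube v k n).dilate 3 ↔ ∀ i, n i - 1 ≤ cell v k x i ∧ cell v k x i < n i + 2 := by
  have hk : (0 : ℝ) < 2 ^ k := by positivity
  simp only [Cube.dilate, dyadicCube, mem_ofPred_eq, cell, Int.floor_lt, Int.le_floor]
  refine forall_congr' fun i => ?_
  rw [le_div_iff₀ hk, div_lt_iff₀ hk]
  push_cast
  constructor <;> rintro ⟨h1, h2⟩ <;> constructor <;> nlinarith

theorem mem_dyadicAt (v : Space d) (k : ℤ) (x : Space d) : x ∈ (dyadicAt v k x).carrier :=
  mem_dyadicCube.2 fun _ => rfl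

theorem dyadicAt_mem (v : Space d) (k : ℤ) (x : Space d) : dyadicAt v k x ∈ dyadicLattice v :=
  dyadicCube_mem _ _ _

theorem exists_eq_dyadicCube {v : Space d} {Q : Cube d} (hQ : Q ∈ dyadicLattice v) :
    ∃ k n, Q = dyadicCube v k n := by
  obtain ⟨k, n, hs, hc⟩ := hQ
  exact ⟨k, n, Cube.eq_of_corner_side hc hs⟩

theorem exists_eq_dyadicAt {v : Space d} {Q : Cube d} (hQ : Q ∈ dyadicLattice v) :
    ∃ k, ∀ x ∈ Q.carrier, Q = dyadicAt v k x := by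
  obtain ⟨k, n, rfl⟩ := exists_eq_dyadicCube hQ
  refine ⟨k, fun x hx => ?_⟩
  rw [dyadicAt, funext (mem_dyadicCube.1 hx)]

/-- The coarse index is the integer quotient of the fine one by `2 ^ (k' - k)`. This is the nesting
of the grids. -/
theorem cell_congr {v : Space d} {k k' : ℤ} (hk : k ≤ k') {x y : Space d} {i : Fin d}
    (h : cell v k x i = cell v k y i) : cell v k' x i = cell v k' y i := by
  have key : ∀ z : Space d, cell v k' z i = cell v k z i / ((2 ^ (k' - k).toNat : ℕ) : ℤ) := by
    intro z
    unfold cell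
    rw [← Int.floor_div_natCast]
    congr 1
    rw [div_div]
    congr 1
    push_cast
    rw [← zpow_natCast, ← zpow_add₀ (by norm_num), Int.toNat_of_nonneg (by omega)]
    congr 1
    omega
  rw [key, key, h]

theorem dyadicAt_congr {v : Space d} {k k' : ℤ} (hk : k ≤ k') {x y : Space d}
    (h : y ∈ (dyadicAt v k x).carrier) : dyadicAt v k' y = dyadicAt v k' x := by
  unfold dyadicAt
  congr 1
  funext i
  exact cell_congr hk (mem_dyadicCube.1 h i)

theorem dyadicAt_subset (v : Space d) {k k' : ℤ} (hk : k ≤ k') (x : Space d) :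
    (dyadicAt v k x).carrier ⊆ (dyadicAt v k' x).carrier := by
  intro y hy
  rw [← dyadicAt_congr hk hy]
  exact mem_dyadicAt _ _ _

/-- The triple of a dyadic cube is a union of cells of its own scale, so no finer dyadic cube
crosses its boundary. -/
theorem dyadicAt_subset_dilate_three {v : Space d} {k K : ℤ} (hk : k ≤ K) {n : Fin d → ℤ}
    {x : Space d} (hx : x ∈ (dyadicCube v K n).dilate 3) :
    (dyadicAt v k x).carrier ⊆ (dyadicCube v K n).dilate 3 := by
  intro y hy
  rw [mem_dilate_three_dyadicCube] at hx ⊢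
  intro i
  rw [cell_congr hk (mem_dyadicCube.1 hy i)]
  exact hx i

/-! ### Inclusions between cubes and their dilates -/

theorem zpow_two_le_iff {k l : ℤ} : (2 : ℝ) ^ k ≤ 2 ^ l ↔ k ≤ l :=
  zpow_le_zpow_iff_right₀ one_lt_two

theorem Cube.bounds_of_subset {Q R : Cube d} (h : Q.carrier ⊆ R.carrier) (i : Fin d) :
    R.corner i ≤ Q.corner i ∧ Q.corner i + Q.side ≤ R.corner i + R.side := by
  refine ⟨(h Q.corner_mem i).1, ?_⟩
  by_contra! hlt
  have hQ := Q.side_pos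
  classical
  -- Cubes are half-open, so the upper corner is not available for testing; this point of `Q` has
  -- its `i`-th coordinate on or beyond the upper face of `R`.
  set x : Space d := WithLp.toLp 2 fun j =>
    if j = i then max (Q.corner i) (R.corner i + R.side) else Q.corner j with hx
  have hmem : x ∈ Q.carrier := by
    intro j
    by_cases hj : j = i
    · subst hj
      simp [hx, hlt, hQ]
    · simp [hx, hj, hQ]
  have := (h hmem i).2
  simp [hx] at this

theorem Cube.side_le_of_subset (hd : 1 ≤ d) {Q R : Cube d} (h : Q.carrier ⊆ R.carrier) :
    Q.side ≤ R.side := by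
  have := Cube.bounds_of_subset h ⟨0, hd⟩
  linarith

theorem Cube.dilate_three_subset {Q R : Cube d} (h : Q.carrier ⊆ R.carrier) :
    Q.dilate 3 ⊆ R.dilate 3 := by
  intro x hx i
  have := Cube.bounds_of_subset h i
  have := hx i
  constructor <;> linarith

theorem Cube.carrier_subset_dilate (Q : Cube d) {t : ℝ} (ht : 1 ≤ t) : Q.carrier ⊆ Q.dilate t := by
  intro x hx i
  have := hx i
  have := Q.side_pos
  constructor <;> nlinarith

theorem Cube.scale_of_side {Q : Cube d} {k : ℤ} (h : Q.side = (2 : ℝ) ^ k) : Q.scale = k := by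
  have : Real.log 2 ≠ 0 := (Real.log_pos one_lt_two).ne'
  rw [Cube.scale, h, Real.logb, Real.log_zpow]
  field_simp

/-! ### Maximal dyadic cubes in an open set -/

/-- The dyadic cubes `L ⊆ 3Q` with `9L ⊆ E`. -/
def whitneyCandidates (v : Space d) (Q : Cube d) (E : Set (Space d)) : Set (Cube d) :=
  {L | L ∈ dyadicLattice v ∧ L.carrier ⊆ Q.dilate 3 ∧ L.dilate 9 ⊆ E}

/-- The maximal dyadic cubes `L ⊆ 3Q` with `9L ⊆ E`. -/
def whitneyCubes (v : Space d) (Q : Cube d) (E : Set (Space d)) : Set (Cube d) :=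
  {L | L ∈ whitneyCandidates v Q E ∧
    ∀ R ∈ whitneyCandidates v Q E, L.carrier ⊆ R.carrier → R = L}

section Whitney

variable {v : Space d} {Q : Cube d} {E : Set (Space d)}

/-- Comparing the volumes of `9L ⊆ E` and `E` gives `288 = 9 * 32`. This smallness makes maximal
cubes exist, keeps their parents inside `3Q`, and keeps `9L` inside `3Q` when `3L` meets `2Q`. -/
theorem side_of_mem_whitneyCandidates (hd : 1 ≤ d)
    (hvol : volume E ≤ ENNReal.ofReal (1 / 32) ^ d * volume Q.carrier)
    {L : Cube d} (hL : L ∈ whitneyCandidates v Q E) : 288 * L.side ≤ Q.side := by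
  have h := (measure_mono (μ := volume) hL.2.2).trans hvol
  rw [Cube.volume_dilate 9 (by norm_num), Cube.volume_carrier, Cube.volume_carrier, ← mul_pow,
    ← mul_pow, ← ENNReal.ofReal_mul (by norm_num), ← ENNReal.ofReal_mul (by norm_num)] at h
  have h1 := (ENNReal.pow_le_pow_left_iff (by omega : d ≠ 0)).1 h
  have := (ENNReal.ofReal_le_ofReal_iff (by have := Q.side_pos; positivity)).1 h1
  linarith

/-- The sides of candidates are bounded, so some candidate containing `R` has the greatest scale. It
is maximal because intersecting dyadic cubes of equal scale coincide. -/
theorem exists_whitneyCube (hd : 1 ≤ d)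
    (hvol : volume E ≤ ENNReal.ofReal (1 / 32) ^ d * volume Q.carrier)
    {R : Cube d} (hR : R ∈ whitneyCandidates v Q E) :
    ∃ L ∈ whitneyCubes v Q E, R.carrier ⊆ L.carrier := by
  obtain ⟨N, hN⟩ : ∃ N : ℕ, Q.side < 2 ^ N := pow_unbounded_of_one_lt _ one_lt_two
  obtain ⟨k, ⟨L, hL, hLs, hRL⟩, hmax⟩ := Int.exists_greatest_of_bdd
    (P := fun k => ∃ L ∈ whitneyCandidates v Q E, L.side = (2 : ℝ) ^ k ∧ R.carrier ⊆ L.carrier)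
    ⟨N, by
      rintro z ⟨L, hL, hLs, -⟩
      have h1 := side_of_mem_whitneyCandidates hd hvol hL
      have h2 := L.side_pos
      rw [← zpow_two_le_iff, ← hLs, zpow_natCast]
      linarith⟩
    (by
      obtain ⟨k, n, hs, hc⟩ := hR.1
      exact ⟨k, R, hR, hs, subset_rfl⟩)
  refine ⟨L, ⟨hL, fun L' hL' hsub => ?_⟩, hRL⟩
  obtain ⟨k', hk'⟩ := exists_eq_dyadicAt hL'.1
  obtain ⟨l, hl⟩ := exists_eq_dyadicAt hL.1
  have e1 := hl _ L.corner_mem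
  have e2 := hk' _ (hsub L.corner_mem)
  have s1 : L.side = 2 ^ l := by rw [e1]; rfl
  have s2 : L'.side = 2 ^ k' := by rw [e2]; rfl
  have hle := hmax k' ⟨L', hL', s2, hRL.trans hsub⟩
  have hlk : l = k := by
    rw [s1] at hLs
    exact zpow_right_injective₀ two_pos (by norm_num) hLs
  have hge : k ≤ k' := by
    rw [← zpow_two_le_iff, ← hLs, ← s2]
    exact Cube.side_le_of_subset hd hsub
  rw [e1, e2, hlk, le_antisymm hle hge]

theorem pairwiseDisjoint_whitneyCubes :
    (whitneyCubes v Q E).PairwiseDisjoint Cube.carrier := by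
  intro L hL R hR hne
  rw [Function.onFun, disjoint_left]
  intro x hxL hxR
  obtain ⟨k, hk⟩ := exists_eq_dyadicAt hL.1.1
  obtain ⟨l, hl⟩ := exists_eq_dyadicAt hR.1.1
  have e1 := hk x hxL
  have e2 := hl x hxR
  rcases le_total k l with h | h
  · exact hne (hL.2 R hR.1 (by rw [e1, e2]; exact dyadicAt_subset v h x)).symm
  · exact hne (hR.2 L hL.1 (by rw [e1, e2]; exact dyadicAt_subset v h x))

theorem countable_of_pairwiseDisjoint {P : Set (Cube d)} (h : P.PairwiseDisjoint Cube.carrier) :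
    P.Countable :=
  PairwiseDisjoint.countable_of_isOpen (s := Cube.inner) (h.mono fun R => R.inner_subset)
    (fun R _ => R.isOpen_inner) (fun R _ => R.nonempty_inner)

/-- The dyadic parent of `L` still lies in `3Q`, so by maximality its 9-fold dilate leaves `E`. The
parent extends `L` by at most one side length and its dilate adds eight more, and `19 = 1 + 2 * 9`.
-/
theorem exists_mem_dilate_notMem (hd : 1 ≤ d) (hQ : Q ∈ dyadicLattice v)
    (hvol : volume E ≤ ENNReal.ofReal (1 / 32) ^ d * volume Q.carrier)
    {L : Cube d} (hL : L ∈ whitneyCubes v Q E) : ∃ y ∈ L.dilate 19, y ∉ E := by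
  obtain ⟨K, n, rfl⟩ := exists_eq_dyadicCube hQ
  obtain ⟨k, hk⟩ := exists_eq_dyadicAt hL.1.1
  set x := L.corner
  have e1 := hk x L.corner_mem
  have hside : L.side = 2 ^ k := by rw [e1]; rfl
  have hsmall := side_of_mem_whitneyCandidates hd hvol hL.1
  have hpos := L.side_pos
  have hkK : k + 1 ≤ K := by
    rw [← zpow_two_le_iff, zpow_add_one₀ two_ne_zero, ← hside]
    change 288 * L.side ≤ 2 ^ K at hsmall
    linarith
  have hLL : L.carrier ⊆ (dyadicAt v (k + 1) x).carrier := by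
    rw [e1]; exact dyadicAt_subset v (by omega) x
  have hcand : ¬ (dyadicAt v (k + 1) x).dilate 9 ⊆ E := by
    intro hE
    have := hL.2 (dyadicAt v (k + 1) x) ⟨dyadicAt_mem _ _ _,
      dyadicAt_subset_dilate_three hkK (hL.1.2.1 L.corner_mem), hE⟩ hLL
    have h2 := congrArg Cube.side this
    rw [side_dyadicAt, hside, zpow_add_one₀ two_ne_zero] at h2
    linarith
  obtain ⟨y, hy, hyE⟩ := not_subset.1 hcand
  refine ⟨y, fun i => ?_, hyE⟩
  have h1 := Cube.bounds_of_subset hLL i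
  have h2 := hy i
  rw [side_dyadicAt, zpow_add_one₀ two_ne_zero, ← hside] at h1 h2
  constructor <;> linarith

theorem mem_iUnion_whitneyCubes (hd : 1 ≤ d) (hQ : Q ∈ dyadicLattice v)
    (hvol : volume E ≤ ENNReal.ofReal (1 / 32) ^ d * volume Q.carrier) (hE : IsOpen E)
    {x : Space d} (hxE : x ∈ E) (hxQ : x ∈ Q.dilate 3) :
    x ∈ ⋃ L ∈ whitneyCubes v Q E, L.carrier := by
  obtain ⟨K, n, rfl⟩ := exists_eq_dyadicCube hQ
  -- In the sup metric of `Fin d → ℝ`, a small enough cube near `x` lies in a ball coordinate by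
  -- coordinate.
  have hE' : IsOpen ((fun z : Fin d → ℝ => (WithLp.toLp 2 z : Space d)) ⁻¹' E) :=
    hE.preimage (PiLp.continuous_toLp 2 _)
  obtain ⟨ε, hε, hball⟩ := Metric.isOpen_iff.1 hE' (WithLp.ofLp x) hxE
  obtain ⟨N, hN⟩ := exists_pow_lt_of_lt_one (show 0 < ε / 9 by positivity)
    (show (1 / 2 : ℝ) < 1 by norm_num)
  -- Small enough for `9L ⊆ E`, and at most `K` so that the dyadic cube around `x` stays in `3Q`.
  set k := min K (-(N : ℤ)) with hk
  have hkε : (2 : ℝ) ^ k < ε / 9 := by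
    refine lt_of_le_of_lt ?_ hN
    rw [one_div, inv_pow, ← zpow_natCast, ← zpow_neg, zpow_two_le_iff]
    exact min_le_right _ _
  have hcand : dyadicAt v k x ∈ whitneyCandidates v (dyadicCube v K n) E := by
    refine ⟨dyadicAt_mem _ _ _, dyadicAt_subset_dilate_three (min_le_left _ _) hxQ, ?_⟩
    intro y hy
    suffices h : WithLp.ofLp y ∈ Metric.ball (WithLp.ofLp x) ε from hball h
    rw [Metric.mem_ball, dist_pi_lt_iff hε]
    intro i
    have h1 := hy i
    have h2 := mem_dyadicAt v k x i
    rw [side_dyadicAt] at h1 h2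
    rw [Real.dist_eq, abs_lt]
    constructor <;> linarith
  obtain ⟨L, hL, hsub⟩ := exists_whitneyCube hd hvol hcand
  exact mem_biUnion hL (hsub (mem_dyadicAt v k x))

theorem isStoppingCollection_whitneyCubes (hd : 1 ≤ d) (hQ : Q ∈ dyadicLattice v)
    (hvol : volume E ≤ ENNReal.ofReal (1 / 32) ^ d * volume Q.carrier) (hE : IsOpen E) :
    IsStoppingCollection (dyadicLattice v) (whitneyCubes v Q E) Q where
  top_mem := hQ
  subset := fun L hL => hL.1.1
  disjoint := pairwiseDisjoint_whitneyCubes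
  contained := fun L hL => hL.1.2.1
  separated := by
    -- If `7L` met `7R` with `R` at least `256` times smaller, all of `19R` would lie in `9L ⊆ E`,
    -- but `19R` contains a point outside `E`.
    have key : ∀ L ∈ whitneyCubes v Q E, ∀ R ∈ whitneyCubes v Q E, 8 ≤ L.scale - R.scale →
        Disjoint (L.dilate 7) (R.dilate 7) := by
      intro L hL R hR hs
      obtain ⟨k, n, rfl⟩ := exists_eq_dyadicCube hL.1.1
      obtain ⟨l, n', rfl⟩ := exists_eq_dyadicCube hR.1.1
      rw [Cube.scale_of_side (k := k) rfl, Cube.scale_of_side (k := l) rfl] at hs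
      have hkl : l + 8 ≤ k := by
        have : (8 : ℝ) + l ≤ k := by linarith
        have : (8 : ℤ) + l ≤ k := by exact_mod_cast this
        omega
      have hside : 256 * (dyadicCube v l n').side ≤ (dyadicCube v k n).side := by
        have : (2 : ℝ) ^ (l + 8) ≤ 2 ^ k := zpow_two_le_iff.2 hkl
        rw [zpow_add₀ two_ne_zero] at this
        change 256 * (2 : ℝ) ^ l ≤ 2 ^ k
        norm_num at this
        linarith
      rw [disjoint_left]
      intro z hz hz'
      obtain ⟨y, hy, hyE⟩ := exists_mem_dilate_notMem hd hQ hvol hR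
      refine hyE (hL.1.2.2 fun i => ?_)
      have h1 := hz i
      have h2 := hz' i
      have h3 := hy i
      have := (dyadicCube v l n').side_pos
      constructor <;> linarith
    intro L hL R hR hs
    rcases le_abs.1 hs with h | h
    · exact key L hL R hR h
    · exact (key R hR L hL (by linarith)).symm
  covered := by
    -- Since `3L` meets `2Q` and `L` is tiny, `9L` lies in `3Q`; it also lies in `E`, and the
    -- maximal cubes cover `E ∩ 3Q`.
    refine iUnion₂_subset fun L hL x hx => ?_
    obtain ⟨hL, z, hz3, hz2⟩ := hL
    refine mem_iUnion_whitneyCubes hd hQ hvol hE (hL.1.2.2 hx) fun i => ?_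
    have h0 := side_of_mem_whitneyCandidates hd hvol hL.1
    have h1 := hx i
    have h2 := hz3 i
    have h3 := hz2 i
    have := L.side_pos
    constructor <;> linarith

theorem tsum_volume_whitneyCubes_le :
    ∑' L : whitneyCubes v Q E, volume (L : Cube d).carrier ≤ volume E := by
  rw [← measure_biUnion (countable_of_pairwiseDisjoint pairwiseDisjoint_whitneyCubes)
    pairwiseDisjoint_whitneyCubes (fun R _ => R.measurableSet_carrier)]
  exact measure_mono (iUnion₂_subset fun L hL =>
    (L.carrier_subset_dilate (by norm_num)).trans hL.1.2.2)

end Whitney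

variable {m : ℕ}

/-! ### Bounded functions with bounded support -/

/-- Measurable bounded functions with bounded support. -/
structure IsTest (u : Space d → ℂ) : Prop where
  aesm : AEStronglyMeasurable u volume
  bdd : ∃ M : ℝ, ∀ x, ‖u x‖ ≤ M
  supp : Bornology.IsBounded (Function.support u)

namespace IsTest

theorem indicator {u : Space d → ℂ} (hu : IsTest u) {S : Set (Space d)} (hS : MeasurableSet S) :
    IsTest (S.indicator u) where
  aesm := hu.aesm.indicator hS
  bdd := by
    obtain ⟨M, hM⟩ := hu.bdd
    exact ⟨M, fun x => (norm_indicator_le_norm_self u x).trans (hM x)⟩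
  supp := hu.supp.subset (by rw [Set.support_indicator]; exact inter_subset_right)

theorem sub {u v : Space d → ℂ} (hu : IsTest u) (hv : IsTest v) : IsTest (u - v) where
  aesm := hu.aesm.sub hv.aesm
  bdd := by
    obtain ⟨M, hM⟩ := hu.bdd
    obtain ⟨N, hN⟩ := hv.bdd
    exact ⟨M + N, fun x => (norm_sub_le _ _).trans (add_le_add (hM x) (hN x))⟩
  supp := (hu.supp.union hv.supp).subset (Function.support_sub u v)

theorem integrable {u : Space d → ℂ} (hu : IsTest u) : Integrable u volume := by
  obtain ⟨M, hM⟩ := hu.bdd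
  obtain ⟨R, hR⟩ := hu.supp.subset_closedBall 0
  rw [← integrableOn_iff_integrable_of_support_subset hR]
  exact Measure.integrableOn_of_bounded measure_closedBall_lt_top.ne hu.aesm
    (.of_forall hM)

end IsTest

/-! ### Integrability -/

theorem aestronglyMeasurable_prod_apply {u : Fin (m + 1) → Space d → ℂ}
    (hu : ∀ i, AEStronglyMeasurable (u i) volume) :
    AEStronglyMeasurable (fun x : Fin (m + 1) → Space d => ∏ i, u i (x i)) volume := by
  have := Finset.aestronglyMeasurable_prod (μ := (volume : Measure (Fin (m + 1) → Space d)))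
    (f := fun i x => u i (x i)) Finset.univ fun i _ =>
    (hu i).comp_quasiMeasurePreserving (Measure.quasiMeasurePreserving_eval _ i)
  simpa [Finset.prod_fn] using this

/-- After translation by `y` the slice is supported in a fixed product of balls, where Hölder's
inequality turns the `L^q` bound into an `L^1` bound uniform in `y`. -/
theorem exists_lintegral_slice_le {K : Kernels d m} {q : ℝ≥0∞} (hq : 1 ≤ q)
    (hK : IsSingleScale K q) (s : ℤ) : ∃ N : ℝ≥0∞, N ≠ ∞ ∧ ∀ y : Space d,
      ∫⁻ z : Fin m → Space d, ‖K s (Fin.insertNth (α := fun _ => Space d) 0 y z)‖ₑ ≤ N := by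
  set c := ENNReal.ofReal ((2 : ℝ) ^ ((m : ℝ) * d * s * (1 - (q⁻¹).toReal))) with hc
  have hc0 : c ≠ 0 := (ENNReal.ofReal_pos.2 (by positivity)).ne'
  have hct : c ≠ ∞ := ENNReal.ofReal_ne_top
  set V : Set (Fin m → Space d) := univ.pi fun _ => Metric.closedBall 0 ((2 : ℝ) ^ s) with hV
  have hVm : MeasurableSet V := MeasurableSet.univ_pi fun _ => Metric.isClosed_closedBall.measurableSet
  have hVt : volume V ≠ ∞ := by
    rw [hV, volume_pi_pi]
    exact ENNReal.prod_ne_top fun _ _ => measure_closedBall_lt_top.ne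
  have hins : ∀ y : Space d, Measurable fun z : Fin m → Space d =>
      (Fin.insertNth (α := fun _ => Space d) 0 y z : Fin (m + 1) → Space d) := fun y =>
    (MeasurableEquiv.piFinSuccAbove (fun _ => Space d) 0).symm.measurable.comp
      measurable_prodMk_left
  have he : 0 ≤ 1 / (1 : ℝ≥0∞).toReal - 1 / q.toReal := by
    rcases eq_or_ne q ∞ with rfl | h
    · simp
    · have : 1 ≤ q.toReal := by simpa using ENNReal.toReal_mono h hq
      simp [inv_le_one_of_one_le₀ this]
  refine ⟨kernelSize K q / c * volume V ^ (1 / (1 : ℝ≥0∞).toReal - 1 / q.toReal),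
    ENNReal.mul_ne_top (ENNReal.div_lt_top hK.size.ne hc0).ne
      (ENNReal.rpow_ne_top_of_nonneg he hVt), fun y => ?_⟩
  set φ : (Fin m → Space d) → ℂ := fun z =>
    K s (Fin.insertNth (α := fun _ => Space d) 0 y (fun j => z j + y)) with hφ
  have hφm : Measurable φ := by
    refine (hK.measurable s).comp ((hins y).comp ?_)
    fun_prop
  have hsize : eLpNorm φ q volume ≤ kernelSize K q / c := by
    rw [ENNReal.le_div_iff_mul_le (Or.inl hc0) (Or.inl hct), mul_comm]
    refine le_trans ?_ (le_iSup _ s)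
    change c * _ ≤ c * _
    gcongr
    refine le_trans ?_ (le_iSup _ y)
    exact Finset.single_le_sum (f := fun i : Fin (m + 1) => eLpNorm (fun z : Fin m → Space d =>
      K s (Fin.insertNth (α := fun _ => Space d) i y (fun j => z j + y))) q volume)
      (fun _ _ => zero_le) (Finset.mem_univ 0)
  have hsupp : Function.support φ ⊆ V := by
    intro z hz j _
    have := hK.support s _ hz j.succ 0
    simpa [hφ] using this
  calc ∫⁻ z : Fin m → Space d, ‖K s (Fin.insertNth (α := fun _ => Space d) 0 y z)‖ₑ
      = ∫⁻ z : Fin m → Space d, ‖φ z‖ₑ := by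
        rw [← lintegral_add_right_eq_self _ (fun _ : Fin m => y)]
        rfl
    _ = eLpNorm φ 1 volume := eLpNorm_one_eq_lintegral_enorm.symm
    _ = eLpNorm φ 1 (volume.restrict V) := by
        rw [← eLpNorm_indicator_eq_eLpNorm_restrict hVm, Set.indicator_eq_self.2 hsupp]
    _ ≤ eLpNorm φ q (volume.restrict V) *
          (volume.restrict V) univ ^ (1 / (1 : ℝ≥0∞).toReal - 1 / q.toReal) :=
        eLpNorm_le_eLpNorm_mul_rpow_measure_univ hq hφm.aestronglyMeasurable
    _ ≤ _ := by
        rw [Measure.restrict_apply_univ]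
        gcongr
        exact (eLpNorm_mono_measure _ Measure.restrict_le_self).trans hsize

/-- All functions are bounded, so it suffices to integrate the kernel: first over the slice with `x
0` fixed, then over the bounded support of `u 0`. -/
theorem integrable_kernel {K : Kernels d m} {q : ℝ≥0∞} (hq : 1 ≤ q) (hK : IsSingleScale K q)
    (s : ℤ) {u : Fin (m + 1) → Space d → ℂ} (hu : ∀ i, IsTest (u i)) :
    Integrable (fun x : Fin (m + 1) → Space d => K s x * ∏ i, u i (x i)) volume := by
  refine ⟨(hK.measurable s).aestronglyMeasurable.mul
    (aestronglyMeasurable_prod_apply fun i => (hu i).aesm), ?_⟩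
  choose M hM using fun i => (hu i).bdd
  obtain ⟨R, hR⟩ := (hu 0).supp.subset_closedBall 0
  set B := Metric.closedBall (0 : Space d) R
  have hBm : MeasurableSet B := Metric.isClosed_closedBall.measurableSet
  obtain ⟨N, hN, hNle⟩ := exists_lintegral_slice_le hq hK s
  set e := MeasurableEquiv.piFinSuccAbove (fun _ : Fin (m + 1) => Space d) 0
  have he : MeasurePreserving e.symm volume volume :=
    (volume_preserving_piFinSuccAbove (fun _ : Fin (m + 1) => Space d) 0).symm e
  have hKm : Measurable fun x : Fin (m + 1) → Space d => ‖K s x‖ₑ := (hK.measurable s).enorm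
  have hindm : Measurable (B.indicator (fun _ : Space d => (1 : ℝ≥0∞))) :=
    measurable_const.indicator hBm
  have hmeas : Measurable fun x : Fin (m + 1) → Space d =>
      B.indicator (fun _ => (1 : ℝ≥0∞)) (x 0) * ‖K s x‖ₑ :=
    (hindm.comp (measurable_pi_apply 0)).mul hKm
  have hfin : ∫⁻ x : Fin (m + 1) → Space d, B.indicator (fun _ => (1 : ℝ≥0∞)) (x 0) * ‖K s x‖ₑ
      < ∞ := by
    rw [← he.lintegral_comp hmeas]
    rw [Measure.volume_eq_prod, lintegral_prod
      (fun z => B.indicator (fun _ => (1 : ℝ≥0∞)) (e.symm z 0) * ‖K s (e.symm z)‖ₑ)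
      (hmeas.comp e.symm.measurable).aemeasurable]
    calc _ ≤ ∫⁻ y : Space d, B.indicator (fun _ => N) y := by
          refine lintegral_mono fun y => ?_
          by_cases hy : y ∈ B
          · rw [indicator_of_mem hy]
            refine le_trans (lintegral_mono fun z => ?_) (hNle y)
            change B.indicator _ y * ‖K s (Fin.insertNth (α := fun _ => Space d) 0 y z)‖ₑ ≤ _
            simp [hy]
          · rw [indicator_of_notMem hy]
            refine le_of_eq ?_
            refine (lintegral_congr fun z => ?_).trans lintegral_zero
            change B.indicator _ y * ‖K s (Fin.insertNth (α := fun _ => Space d) 0 y z)‖ₑ = _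
            simp [hy]
      _ = N * volume B := by rw [lintegral_indicator_const hBm]
      _ < ∞ := ENNReal.mul_lt_top hN.lt_top measure_closedBall_lt_top
  rw [HasFiniteIntegral]
  calc ∫⁻ x : Fin (m + 1) → Space d, ‖K s x * ∏ i, u i (x i)‖ₑ
      ≤ ∫⁻ x : Fin (m + 1) → Space d, (∏ i, ENNReal.ofReal (M i)) *
          (B.indicator (fun _ => (1 : ℝ≥0∞)) (x 0) * ‖K s x‖ₑ) := by
        refine lintegral_mono fun x => ?_
        by_cases hx : x 0 ∈ B
        · rw [indicator_of_mem hx, one_mul, enorm_mul, mul_comm]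
          gcongr
          have : ‖∏ i, u i (x i)‖ₑ = ∏ i, ‖u i (x i)‖ₑ := by
            simp only [enorm, nnnorm_prod]
            push_cast; rfl
          rw [this]
          refine Finset.prod_le_prod' fun i _ => ?_
          rw [← ofReal_norm]
          exact ENNReal.ofReal_le_ofReal (hM i _)
        · have h0 : u 0 (x 0) = 0 := by
            by_contra h; exact hx (hR h)
          rw [Finset.prod_eq_zero (Finset.mem_univ 0) h0]
          simp
    _ = (∏ i, ENNReal.ofReal (M i)) *
          ∫⁻ x : Fin (m + 1) → Space d, B.indicator (fun _ => (1 : ℝ≥0∞)) (x 0) * ‖K s x‖ₑ :=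
        lintegral_const_mul _ hmeas
    _ < ∞ := ENNReal.mul_lt_top (ENNReal.prod_lt_top fun _ _ => ENNReal.ofReal_lt_top) hfin

theorem integrable_sum_kernel {K : Kernels d m} {q : ℝ≥0∞} (hq : 1 ≤ q) (hK : IsSingleScale K q)
    (A : Finset ℤ) {u : Fin (m + 1) → Space d → ℂ} (hu : ∀ i, IsTest (u i)) :
    Integrable (fun x : Fin (m + 1) → Space d => (∑ s ∈ A, K s x) * ∏ i, u i (x i)) volume := by
  simp only [Finset.sum_mul]
  exact integrable_finsetSum _ fun s _ => integrable_kernel hq hK s hu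

/-! ### Algebra of forms -/

/-- Additivity in slot `n`, phrased with three tuples so that it applies both to the indicator
inserted in slot `0` by `localForm` and to telescoping tuples. -/
theorem form_add {K : Kernels d m} {q : ℝ≥0∞} (hq : 1 ≤ q) (hK : IsSingleScale K q)
    (A : Finset ℤ) (n : Fin (m + 1)) {u v w : Fin (m + 1) → Space d → ℂ}
    (hv : ∀ i, IsTest (v i)) (hw : ∀ i, IsTest (w i)) (hn : v n + w n = u n)
    (hvu : ∀ j, j ≠ n → v j = u j) (hwu : ∀ j, j ≠ n → w j = u j) :
    form K A u = form K A v + form K A w := by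
  unfold form
  rw [← integral_add (integrable_sum_kernel hq hK A hv) (integrable_sum_kernel hq hK A hw)]
  refine integral_congr_ae (.of_forall fun x => ?_)
  simp only
  rw [← mul_add, Finset.prod_add_prod_eq (f := fun i => u i (x i)) (Finset.mem_univ n)
    (by rw [← hn]; rfl) (fun j _ hj => by rw [hvu j hj]) (fun j _ hj => by rw [hwu j hj])]

theorem localForm_add {K : Kernels d m} {q : ℝ≥0∞} (hq : 1 ≤ q) (hK : IsSingleScale K q)
    (μ ν : ℤ) (L : Cube d) (n : Fin (m + 1)) {u v w : Fin (m + 1) → Space d → ℂ}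
    (hv : ∀ i, IsTest (v i)) (hw : ∀ i, IsTest (w i)) (hn : v n + w n = u n)
    (hvu : ∀ j, j ≠ n → v j = u j) (hwu : ∀ j, j ≠ n → w j = u j) :
    localForm K μ ν L u = localForm K μ ν L v + localForm K μ ν L w := by
  have htest : ∀ {v : Fin (m + 1) → Space d → ℂ}, (∀ i, IsTest (v i)) →
      ∀ i, IsTest (Function.update v 0 (L.carrier.indicator (v 0)) i) := by
    intro v hv i
    rcases eq_or_ne i 0 with rfl | hi
    · simpa using (hv 0).indicator L.measurableSet_carrier
    · simpa [hi] using hv i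
  have hoff : ∀ {v : Fin (m + 1) → Space d → ℂ}, (∀ j, j ≠ n → v j = u j) → ∀ j, j ≠ n →
      Function.update v 0 (L.carrier.indicator (v 0)) j
        = Function.update u 0 (L.carrier.indicator (u 0)) j := by
    intro v hv j hj
    rcases eq_or_ne j 0 with rfl | h0
    · simp [hv 0 hj]
    · simp [h0, hv j hj]
  refine form_add hq hK _ n (htest hv) (htest hw) ?_ (hoff hvu) (hoff hwu)
  rcases eq_or_ne n 0 with rfl | h0
  · simp only [Function.update_self]
    rw [← Set.indicator_add', hn]
  · simpa [h0] using hn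

theorem form_eq_zero_of_ae {K : Kernels d m} (A : Finset ℤ) {u : Fin (m + 1) → Space d → ℂ}
    {n : Fin (m + 1)} (hn : u n =ᵐ[volume] 0) : form K A u = 0 := by
  refine integral_eq_zero_of_ae ?_
  have := (Measure.quasiMeasurePreserving_eval
    (fun _ : Fin (m + 1) => (volume : Measure (Space d))) n).ae hn
  filter_upwards [this] with x hx
  rw [Finset.prod_eq_zero (Finset.mem_univ n) hx]
  simp

theorem localForm_eq_zero_of_ae {K : Kernels d m} (μ ν : ℤ) (L : Cube d)
    {u : Fin (m + 1) → Space d → ℂ} {n : Fin (m + 1)} (hn : u n =ᵐ[volume] 0) :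
    localForm K μ ν L u = 0 := by
  refine form_eq_zero_of_ae (n := n) _ ?_
  rcases eq_or_ne n 0 with rfl | h0
  · rw [Function.update_self]
    filter_upwards [hn] with x hx
    by_cases h : x ∈ L.carrier <;> simp [h, hx]
  · rwa [Function.update_of_ne h0]

theorem localForm_eq_zero_of_scale_le {K : Kernels d m} {μ ν : ℤ} {L : Cube d}
    (hL : L.scale ≤ μ) (u : Fin (m + 1) → Space d → ℂ) : localForm K μ ν L u = 0 := by
  classical
  have : ((Finset.Ioo μ ν).filter fun s : ℤ => (s : ℝ) ≤ L.scale) = ∅ := by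
    refine Finset.filter_eq_empty_iff.2 fun s hs h => ?_
    have h1 := (Finset.mem_Ioo.1 hs).1
    have h2 : (s : ℝ) ≤ μ := h.trans hL
    have h3 : s ≤ μ := by exact_mod_cast h2
    omega
  unfold localForm
  simp [form, this]

theorem mem_dilate_three_of_norm_le {L : Cube d} {x y : Space d} (hx : x ∈ L.carrier)
    {r : ℝ} (hxy : ‖y - x‖ ≤ r) (hr : r ≤ L.side) : y ∈ L.dilate 3 := by
  intro i
  have h1 : |y i - x i| ≤ r := by
    have := PiLp.norm_apply_le (y - x) i
    rw [Real.norm_eq_abs] at this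
    exact this.trans hxy
  have := abs_le.1 h1
  have := hx i
  constructor <;> linarith

/-- If `x 0 ∈ L` and the scale is at most that of `L`, the kernel vanishes unless every `x j` is
within `L.side` of `x 0`, hence in `3L`. -/
theorem localForm_congr {K : Kernels d m} {q : ℝ≥0∞} (hK : IsSingleScale K q) (μ ν : ℤ)
    {L : Cube d} {k : ℤ} (hk : L.side = (2 : ℝ) ^ k) {u w : Fin (m + 1) → Space d → ℂ}
    (h : ∀ j, EqOn (u j) (w j) (L.dilate 3)) : localForm K μ ν L u = localForm K μ ν L w := by
  unfold localForm form
  refine integral_congr_ae (.of_forall fun x => ?_)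
  simp only
  by_cases hx0 : x 0 ∈ L.carrier
  · by_cases hx : ∀ j, x j ∈ L.dilate 3
    · congr 1
      refine Finset.prod_congr rfl fun j _ => ?_
      rcases eq_or_ne j 0 with rfl | h0
      · simp [hx0, h 0 (hx 0)]
      · simp [h0, h j (hx j)]
    · push Not at hx
      obtain ⟨j, hj⟩ := hx
      rw [Finset.sum_eq_zero, zero_mul, zero_mul]
      intro s hs
      by_contra hne
      have h1 := (Finset.mem_filter.1 hs).2
      rw [Cube.scale_of_side hk] at h1
      have h2 : s ≤ k := by exact_mod_cast h1
      exact hj (mem_dilate_three_of_norm_le hx0 (hK.support s x hne j 0)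
        (by rw [hk]; exact zpow_two_le_iff.2 h2))
  · rw [Finset.prod_eq_zero (Finset.mem_univ 0) (by simp [hx0]),
      Finset.prod_eq_zero (Finset.mem_univ 0) (by simp [hx0])]

/-! ### Norm bounds from the truncation bound -/

/-- Homogeneity. Dividing by upper bounds `t i` instead of the norms themselves avoids division by
zero. -/
theorem enorm_truncForm_le {K : Kernels d m} (ρ : Fin (m + 1) → ℝ≥0∞) (μ ν : ℤ)
    {u : Fin (m + 1) → Space d → ℂ} (hu : ∀ i, AEStronglyMeasurable (u i) volume)
    {t : Fin (m + 1) → ℝ≥0∞} (ht0 : ∀ i, t i ≠ 0) (htt : ∀ i, t i ≠ ∞)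
    (hut : ∀ i, eLpNorm (u i) (ρ i) volume ≤ t i) :
    ‖truncForm K μ ν u‖ₑ ≤ truncationBound K ρ * ∏ i, t i := by
  set w : Fin (m + 1) → Space d → ℂ := fun i => (((t i).toReal⁻¹ : ℝ) : ℂ) • u i with hw
  have hpos : ∀ i, 0 < (t i).toReal := fun i => ENNReal.toReal_pos (ht0 i) (htt i)
  have hwn : ∀ i, eLpNorm (w i) (ρ i) volume ≤ 1 := by
    intro i
    rw [hw, eLpNorm_const_smul]
    have : ‖(((t i).toReal⁻¹ : ℝ) : ℂ)‖ₑ = (t i)⁻¹ := by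
      rw [← ofReal_norm, Complex.norm_real, Real.norm_of_nonneg (by have := hpos i; positivity),
        ENNReal.ofReal_inv_of_pos (hpos i), ENNReal.ofReal_toReal (htt i)]
    rw [this]
    calc (t i)⁻¹ * eLpNorm (u i) (ρ i) volume ≤ (t i)⁻¹ * t i := by gcongr; exact hut i
      _ = 1 := ENNReal.inv_mul_cancel (ht0 i) (htt i)
  have hw1 : ‖truncForm K μ ν w‖ₑ ≤ truncationBound K ρ := by
    unfold truncationBound
    refine le_iSup₂_of_le μ ν (le_iSup₂_of_le w (fun i => ⟨⟨(hu i).const_smul _, ?_⟩, hwn i⟩) le_rfl)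
    exact (hwn i).trans_lt ENNReal.one_lt_top
  have huw : truncForm K μ ν u = (∏ i, (((t i).toReal : ℝ) : ℂ)) * truncForm K μ ν w := by
    unfold truncForm form
    rw [← integral_const_mul]
    refine integral_congr_ae (.of_forall fun x => ?_)
    simp only
    rw [mul_left_comm, ← Finset.prod_mul_distrib]
    congr 1
    refine Finset.prod_congr rfl fun i _ => ?_
    have : (((t i).toReal : ℝ) : ℂ) ≠ 0 := by exact_mod_cast (hpos i).ne'
    simp only [hw, Pi.smul_apply, smul_eq_mul, Complex.ofReal_inv]
    rw [mul_inv_cancel_left₀ this]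
  have hprod : ‖∏ i, (((t i).toReal : ℝ) : ℂ)‖ₑ = ∏ i, t i := by
    have : ‖∏ i, (((t i).toReal : ℝ) : ℂ)‖ₑ = ∏ i, ‖(((t i).toReal : ℝ) : ℂ)‖ₑ := by
      simp only [enorm, nnnorm_prod]
      push_cast; rfl
    rw [this]
    refine Finset.prod_congr rfl fun i _ => ?_
    rw [← ofReal_norm, Complex.norm_real, Real.norm_of_nonneg (hpos i).le,
      ENNReal.ofReal_toReal (htt i)]
  rw [huw, enorm_mul, hprod, mul_comm]
  gcongr

theorem prod_rpow_eq {ι : Type*} {T : Finset ι} {a : ℝ≥0∞} (h0 : a ≠ 0) (ht : a ≠ ∞)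
    (r : ι → ℝ) : ∏ i ∈ T, a ^ r i = a ^ ∑ i ∈ T, r i := by
  classical
  induction T using Finset.induction_on with
  | empty => simp
  | insert i T hi ih => rw [Finset.prod_insert hi, Finset.sum_insert hi, ih, ENNReal.rpow_add _ _ h0 ht]

/-- A localized form is a truncated form of the functions cut off to `3L`. The cutoffs have `L^{ρ
i}` norm at most `G i * |3L|^{1/ρ i}`, and the exponents `1/ρ i` add up to `1`. -/
theorem enorm_localForm_le {K : Kernels d m} {q : ℝ≥0∞} (hK : IsSingleScale K q)
    {ρ : Fin (m + 1) → ℝ≥0∞} (hρ1 : ∀ i, 1 ≤ ρ i) (hρ : ∑ i, (ρ i)⁻¹ = 1) (μ ν : ℤ)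
    {L : Cube d} {k : ℤ} (hk : L.side = (2 : ℝ) ^ k) {u : Fin (m + 1) → Space d → ℂ}
    (hu : ∀ i, AEStronglyMeasurable (u i) volume) {G : Fin (m + 1) → ℝ≥0∞} (hG0 : ∀ i, G i ≠ 0)
    (hGt : ∀ i, G i ≠ ∞) (huG : ∀ i, eLpNorm (u i) ∞ volume ≤ G i) :
    ‖localForm K μ ν L u‖ₑ ≤ truncationBound K ρ * (3 ^ d * volume L.carrier * ∏ i, G i) := by
  set L3 := L.dil 3 (by norm_num) with hL3
  have hc3 : L3.carrier = L.dilate 3 := Cube.carrier_dil _ _ _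
  have hLL3 : L.carrier ⊆ L3.carrier := by
    rw [hc3]; exact L.carrier_subset_dilate (by norm_num)
  -- The range of scales is open, so `s ≤ k` becomes the upper endpoint `k + 1`.
  have hfil : ((Finset.Ioo μ ν).filter fun s : ℤ => (s : ℝ) ≤ L.scale)
      = Finset.Ioo μ (min ν (k + 1)) := by
    ext s
    rw [Cube.scale_of_side hk]
    simp only [Finset.mem_filter, Finset.mem_Ioo, Int.cast_le]
    omega
  rw [localForm_congr hK μ ν hk (w := fun j => L3.carrier.indicator (u j)) fun j x hx => by
    rw [indicator_of_mem (hc3 ▸ hx)]]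
  set w : Fin (m + 1) → Space d → ℂ := Function.update (fun j => L3.carrier.indicator (u j)) 0
    (L.carrier.indicator (L3.carrier.indicator (u 0))) with hw
  have hrew : localForm K μ ν L (fun j => L3.carrier.indicator (u j))
      = truncForm K μ (min ν (k + 1)) w := by
    unfold localForm truncForm
    congr 1
  rw [hrew]
  have hv0 := L3.volume_carrier_ne_zero
  have hvt := L3.volume_carrier_ne_top
  refine (enorm_truncForm_le ρ μ _ (t := fun i => G i * volume L3.carrier ^ ((ρ i)⁻¹).toReal)
    (fun i => ?_) (fun i => ?_) (fun i => ?_) (fun i => ?_)).trans ?_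
  · have hi := (hu i).indicator L3.measurableSet_carrier
    rcases eq_or_ne i 0 with rfl | h0
    · simpa [hw] using hi.indicator L.measurableSet_carrier
    · simpa [hw, h0] using hi
  · exact mul_ne_zero (hG0 i) (ENNReal.rpow_pos L3.volume_carrier_pos hvt).ne'
  · exact ENNReal.mul_ne_top (hGt i) (ENNReal.rpow_ne_top_of_nonneg ENNReal.toReal_nonneg hvt)
  · have hle : eLpNorm (L3.carrier.indicator (u i)) (ρ i) volume
        ≤ G i * volume L3.carrier ^ ((ρ i)⁻¹).toReal :=
      (eLpNorm_indicator_carrier_le _ _).trans (mul_le_mul_left (huG i) _)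
    rcases eq_or_ne i 0 with rfl | h0
    · rw [hw, Function.update_self]
      exact (eLpNorm_indicator_le _).trans hle
    · rw [hw, Function.update_of_ne h0]
      exact hle
  · gcongr
    refine le_of_eq ?_
    rw [Finset.prod_mul_distrib, mul_comm]
    congr 1
    rw [prod_rpow_eq hv0 hvt, ← ENNReal.toReal_sum
      (fun i _ => ENNReal.inv_ne_top.2 (zero_lt_one.trans_le (hρ1 i)).ne'), hρ, hL3,
      Cube.volume_dil]
    simp

/-! ### Stopping forms as finite sums -/

theorem finite_scale_gt {P : Set (Cube d)} (hP : ∑' L : P, volume (L : Cube d).carrier ≠ ∞)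
    (μ : ℤ) : {L ∈ P | (μ : ℝ) < L.scale}.Finite := by
  have hε : ENNReal.ofReal ((2 : ℝ) ^ μ) ^ d ≠ 0 :=
    (ENNReal.pow_pos (ENNReal.ofReal_pos.2 (by positivity)) _).ne'
  have := ENNReal.finite_const_le_of_tsum_ne_top hP hε
  refine (this.image Subtype.val).subset ?_
  rintro L ⟨hL, hs⟩
  refine ⟨⟨L, hL⟩, ?_, rfl⟩
  simp only [mem_ofPred_eq, Cube.volume_carrier]
  gcongr
  rw [Cube.scale, Real.lt_logb_iff_rpow_lt one_lt_two L.side_pos, Real.rpow_intCast] at hs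
  exact hs.le

/-- Cubes of scale above `μ` have volume bounded below, so there are finitely many, and the others
contribute zero. Hence the series in `stoppingForm` is a genuine finite sum, never the default value
of a divergent `tsum`. -/
theorem exists_stoppingForm_eq_sum {P : Set (Cube d)}
    (hP : ∑' L : P, volume (L : Cube d).carrier ≠ ∞) (Q : Cube d) (μ : ℤ) :
    ∃ T : Finset (Cube d),
      (∀ L, L ∈ T ↔ (L ∈ P ∧ L.carrier ⊆ Q.carrier) ∧ (μ : ℝ) < L.scale) ∧
      ∀ (m : ℕ) (K : Kernels d m) (ν : ℤ) (u : Fin (m + 1) → Space d → ℂ),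
        stoppingForm K μ ν P Q u = localForm K μ ν Q u - ∑ L ∈ T, localForm K μ ν L u := by
  have hfin : {L : Cube d | (L ∈ P ∧ L.carrier ⊆ Q.carrier) ∧ (μ : ℝ) < L.scale}.Finite :=
    (finite_scale_gt hP μ).subset fun L hL => ⟨hL.1.1, hL.2⟩
  refine ⟨hfin.toFinset, fun L => by simp, fun m K ν u => ?_⟩
  unfold stoppingForm
  congr 1
  have h1 := tsum_subtype {L : Cube d | L ∈ P ∧ L.carrier ⊆ Q.carrier}
    (fun L => localForm K μ ν L u)
  refine h1.trans ?_
  rw [tsum_eq_sum (s := hfin.toFinset)]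
  · refine Finset.sum_congr rfl fun L hL => ?_
    rw [indicator_of_mem]
    exact (hfin.mem_toFinset.1 hL).1
  · intro L hL
    by_cases hmem : L ∈ {L : Cube d | L ∈ P ∧ L.carrier ⊆ Q.carrier}
    · rw [indicator_of_mem hmem]
      refine localForm_eq_zero_of_scale_le ?_ u
      by_contra! hlt
      exact hL (hfin.mem_toFinset.2 ⟨hmem, hlt⟩)
    · rw [indicator_of_notMem hmem]

theorem stoppingForm_add {K : Kernels d m} {q : ℝ≥0∞} (hq : 1 ≤ q) (hK : IsSingleScale K q)
    (μ ν : ℤ) {P : Set (Cube d)} (hP : ∑' L : P, volume (L : Cube d).carrier ≠ ∞) (Q : Cube d)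
    (n : Fin (m + 1)) {u v w : Fin (m + 1) → Space d → ℂ}
    (hv : ∀ i, IsTest (v i)) (hw : ∀ i, IsTest (w i)) (hn : v n + w n = u n)
    (hvu : ∀ j, j ≠ n → v j = u j) (hwu : ∀ j, j ≠ n → w j = u j) :
    stoppingForm K μ ν P Q u = stoppingForm K μ ν P Q v + stoppingForm K μ ν P Q w := by
  obtain ⟨T, -, hT⟩ := exists_stoppingForm_eq_sum hP Q μ
  rw [hT, hT, hT, localForm_add hq hK μ ν Q n hv hw hn hvu hwu,
    Finset.sum_congr rfl fun L _ => localForm_add hq hK μ ν L n hv hw hn hvu hwu,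
    Finset.sum_add_distrib]
  ring

/-! ### Calderón–Zygmund decomposition -/

open Classical in
/-- The function equal to the mean of `h` on each cube of `P` and to `h` elsewhere. -/
noncomputable def goodPart (P : Set (Cube d)) (h : Space d → ℂ) (x : Space d) : ℂ :=
  if hx : ∃ L ∈ P, x ∈ L.carrier then ⨍ y in (Classical.choose hx).carrier, h y else h x

section CalderonZygmund

variable {P : Set (Cube d)} {h : Space d → ℂ}

theorem goodPart_of_mem (hP : P.PairwiseDisjoint Cube.carrier) {L : Cube d} (hL : L ∈ P)
    {x : Space d} (hx : x ∈ L.carrier) : goodPart P h x = ⨍ y in L.carrier, h y := by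
  have hex : ∃ L ∈ P, x ∈ L.carrier := ⟨L, hL, hx⟩
  rw [goodPart, dif_pos hex, hP.elim_set (Classical.choose_spec hex).1 hL x
    (Classical.choose_spec hex).2 hx]

theorem goodPart_of_notMem {x : Space d} (hx : x ∉ ⋃ L ∈ P, L.carrier) :
    goodPart P h x = h x := by
  rw [goodPart, dif_neg]
  simpa using hx

theorem enorm_average_le (h : Space d → ℂ) (L : Cube d) :
    ‖⨍ y in L.carrier, h y‖ₑ ≤ average h 1 L := by
  rw [average_one_eq, average_eq, enorm_smul]
  gcongr
  · rw [measureReal_restrict_apply_univ, measureReal_def, ← ENNReal.toReal_inv,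
      Real.enorm_of_nonneg ENNReal.toReal_nonneg]
    exact ENNReal.ofReal_toReal_le
  · exact enorm_integral_le_lintegral_enorm _

theorem aestronglyMeasurable_goodPart (hP : P.PairwiseDisjoint Cube.carrier)
    (hh : AEStronglyMeasurable h volume) : AEStronglyMeasurable (goodPart P h) volume := by
  have hcount : P.Countable := countable_of_pairwiseDisjoint hP
  have hU : MeasurableSet (⋃ L ∈ P, L.carrier) :=
    MeasurableSet.biUnion hcount fun L _ => L.measurableSet_carrier
  have h1 : AEStronglyMeasurable (goodPart P h) (volume.restrict (⋃ L ∈ P, L.carrier)) := by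
    have := hcount.to_subtype
    rw [biUnion_eq_iUnion, aestronglyMeasurable_iUnion_iff]
    rintro ⟨L, hL⟩
    refine (aestronglyMeasurable_const (b := ⨍ y in L.carrier, h y)).congr ?_
    filter_upwards [ae_restrict_mem L.measurableSet_carrier] with x hx
    exact (goodPart_of_mem hP hL hx).symm
  have h2 : AEStronglyMeasurable (goodPart P h) (volume.restrict (⋃ L ∈ P, L.carrier)ᶜ) := by
    refine (hh.mono_measure Measure.restrict_le_self).congr ?_
    filter_upwards [ae_restrict_mem hU.compl] with x hx
    exact (goodPart_of_notMem hx).symm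
  have := aestronglyMeasurable_union_iff.2 ⟨h1, h2⟩
  rwa [union_compl_self, Measure.restrict_univ] at this

theorem support_goodPart_subset :
    Function.support (goodPart P h) ⊆ Function.support h ∪ ⋃ L ∈ P, L.carrier := by
  intro x hx
  by_cases hU : x ∈ ⋃ L ∈ P, L.carrier
  · exact Or.inr hU
  · refine Or.inl ?_
    rwa [Function.mem_support, goodPart_of_notMem hU] at hx

theorem isTest_goodPart (hP : P.PairwiseDisjoint Cube.carrier)
    (hb : Bornology.IsBounded (⋃ L ∈ P, L.carrier)) (hh : IsTest h) : IsTest (goodPart P h) where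
  aesm := aestronglyMeasurable_goodPart hP hh.aesm
  bdd := by
    obtain ⟨M, hM⟩ := hh.bdd
    refine ⟨M, fun x => ?_⟩
    by_cases hx : ∃ L ∈ P, x ∈ L.carrier
    · obtain ⟨L, hL, hx⟩ := hx
      rw [goodPart_of_mem hP hL hx, average_eq, norm_smul]
      have hM0 : 0 ≤ M := (norm_nonneg _).trans (hM x)
      have hpos : 0 < volume.real L.carrier :=
        ENNReal.toReal_pos L.volume_carrier_ne_zero L.volume_carrier_ne_top
      have := norm_setIntegral_le_of_norm_le_const (μ := volume) (s := L.carrier)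
        L.volume_carrier_ne_top.lt_top (C := M) (f := h) (fun x _ => hM x)
      rw [measureReal_restrict_apply_univ, norm_inv, Real.norm_of_nonneg hpos.le,
        inv_mul_le_iff₀ hpos, mul_comm]
      exact this
    · rw [goodPart_of_notMem (by simpa using hx)]
      exact hM x
  supp := (hh.supp.union hb).subset support_goodPart_subset

theorem eLpNorm_goodPart_le (hP : P.PairwiseDisjoint Cube.carrier) {t : ℝ≥0∞}
    (hoff : ∀ᵐ x, x ∉ ⋃ L ∈ P, L.carrier → ‖h x‖ₑ ≤ t) (hon : ∀ L ∈ P, average h 1 L ≤ t) :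
    eLpNorm (goodPart P h) ∞ volume ≤ t := by
  rw [eLpNorm_exponent_top]
  refine eLpNormEssSup_le_of_ae_enorm_bound ?_
  filter_upwards [hoff] with x hx
  by_cases hU : ∃ L ∈ P, x ∈ L.carrier
  · obtain ⟨L, hL, hxL⟩ := hU
    rw [goodPart_of_mem hP hL hxL]
    exact (enorm_average_le h L).trans (hon L hL)
  · have hU' : x ∉ ⋃ L ∈ P, L.carrier := by simpa using hU
    rw [goodPart_of_notMem hU']
    exact hx hU'

theorem isMeanZeroOn_sub_goodPart (hP : P.PairwiseDisjoint Cube.carrier) (hint : Integrable h) :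
    IsMeanZeroOn P (h - goodPart P h) := by
  refine ⟨fun x hx => ?_, fun L hL => ?_⟩
  · by_contra hU
    exact hx (by simp [goodPart_of_notMem hU])
  · have hEq : EqOn (fun x => h x - ⨍ y in L.carrier, h y) (h - goodPart P h) L.carrier := by
      intro x hx
      simp [goodPart_of_mem hP hL hx]
    have hfin : IsFiniteMeasure (volume.restrict L.carrier) :=
      ⟨by rw [Measure.restrict_apply_univ]; exact L.volume_carrier_ne_top.lt_top⟩
    refine ⟨?_, ?_⟩
    · refine IntegrableOn.congr_fun ?_ hEq L.measurableSet_carrier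
      exact hint.integrableOn.sub (integrable_const _)
    · rw [← setIntegral_congr_fun L.measurableSet_carrier hEq]
      exact integral_sub_average _ _

theorem yNorm_top_eq (P : Set (Cube d)) (h : Space d → ℂ) :
    yNorm P ∞ h = eLpNorm h ∞ volume := by
  simp [yNorm]

/-- A function is controlled at level `t` by the collection `P`: it is at most `t` off the cubes,
and each of them has a dilate containing a point where its maximal function is at most `t`. -/
structure IsControlled (P : Set (Cube d)) (p t : ℝ≥0∞) (h : Space d → ℂ) : Prop where
  off : ∀ᵐ x, x ∉ ⋃ L ∈ P, L.carrier → ‖h x‖ₑ ≤ t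
  maximal_le : ∀ L ∈ P, ∃ x ∈ L.dilate (2 ^ 5), maximal p h x ≤ t
  average_le : ∀ L ∈ P, average h 1 L ≤ t
  top : p = ∞ → eLpNorm h ∞ volume ≤ t

variable {p t : ℝ≥0∞}

theorem IsControlled.yNorm_le (hc : IsControlled P p t h) : yNorm P p h ≤ t := by
  unfold yNorm
  split_ifs with hp
  · exact hc.top hp
  · refine max_le ?_ (iSup₂_le fun L hL => ?_)
    · rw [eLpNorm_exponent_top]
      refine eLpNormEssSup_le_of_ae_enorm_bound ?_
      filter_upwards [hc.off] with x hx
      by_cases hU : x ∈ ⋃ L ∈ P, L.carrier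
      · rw [indicator_of_notMem (by simpa using hU)]
        simp
      · rw [indicator_of_mem (by simpa using hU)]
        exact hx hU
    · obtain ⟨x, hx, hle⟩ := hc.maximal_le L hL
      exact iInf₂_le_of_le x hx hle

theorem IsControlled.yNorm_goodPart_le (hP : P.PairwiseDisjoint Cube.carrier)
    (hc : IsControlled P p t h) : yNorm P ∞ (goodPart P h) ≤ t := by
  rw [yNorm_top_eq]
  exact eLpNorm_goodPart_le hP hc.off hc.average_le

/-- For `p < ∞` the bad part vanishes off the cubes, and at the point of `32L` where the maximal
function of `h` is at most `t`, subtracting a function bounded by `t` adds at most `t`. -/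
theorem IsControlled.yNorm_sub_goodPart_le (hP : P.PairwiseDisjoint Cube.carrier) (hp : 1 ≤ p)
    (hh : AEStronglyMeasurable h volume) (hc : IsControlled P p t h) :
    yNorm P p (h - goodPart P h) ≤ 2 * t := by
  have hg : AEStronglyMeasurable (goodPart P h) volume := aestronglyMeasurable_goodPart hP hh
  have hgt := eLpNorm_goodPart_le hP hc.off hc.average_le
  unfold yNorm
  split_ifs with hpt
  · rw [two_mul]
    exact (eLpNorm_sub_le hh hg le_top).trans (add_le_add (hc.top hpt) hgt)
  · refine max_le ?_ (iSup₂_le fun L hL => ?_)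
    · rw [show ((⋃ L ∈ P, L.carrier)ᶜ.indicator (h - goodPart P h)) = 0 from ?_]
      · simp
      · funext x
        by_cases hU : x ∈ ⋃ L ∈ P, L.carrier
        · rw [indicator_of_notMem (by simpa using hU)]
          rfl
        · rw [indicator_of_mem (by simpa using hU)]
          simp [goodPart_of_notMem hU]
    · obtain ⟨x, hx, hle⟩ := hc.maximal_le L hL
      refine iInf₂_le_of_le x hx (iSup₂_le fun R hR => ?_)
      rw [sub_eq_add_neg, two_mul]
      refine (average_add_le hp hh hg.neg R).trans (add_le_add ?_ ?_)
      · exact (le_iSup₂_of_le (f := fun (R : Cube d) (_ : x ∈ R.carrier) => average h p R)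
          R hR le_rfl).trans hle
      · refine (average_le_eLpNorm_top _ R).trans ?_
        rw [eLpNorm_neg]
        exact hgt

end CalderonZygmund

/-! ### Construction of the stopping collection -/

/-- The points interior to a cube over which some average of `h i` exceeds `C a i`. -/
def exceptionalSet (p : Fin (m + 1) → ℝ≥0∞) (h : Fin (m + 1) → Space d → ℂ) (C : ℝ≥0∞)
    (a : Fin (m + 1) → ℝ≥0∞) : Set (Space d) :=
  ⋃ i, ⋃ R ∈ {R : Cube d | C * a i < average (h i) (p i) R}, R.inner

theorem isOpen_exceptionalSet (p : Fin (m + 1) → ℝ≥0∞) (h : Fin (m + 1) → Space d → ℂ)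
    (C : ℝ≥0∞) (a : Fin (m + 1) → ℝ≥0∞) : IsOpen (exceptionalSet p h C a) :=
  isOpen_iUnion fun _ => isOpen_biUnion fun R _ => R.isOpen_inner

/-- A cube containing `x` lies in the interior of its double, so the double is not exceptional;
doubling costs `2 ^ d`. -/
theorem maximal_le_of_notMem_exceptionalSet {p : Fin (m + 1) → ℝ≥0∞} (hp : ∀ i, 1 ≤ p i)
    {h : Fin (m + 1) → Space d → ℂ} {C : ℝ≥0∞} {a : Fin (m + 1) → ℝ≥0∞} {x : Space d}
    (hx : x ∉ exceptionalSet p h C a) (i : Fin (m + 1)) :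
    maximal (p i) (h i) x ≤ 2 ^ d * (C * a i) := by
  refine iSup₂_le fun R hR => ?_
  have h1 : average (h i) (p i) R ≤ 2 ^ d * average (h i) (p i) (R.dil 2 two_pos) := by
    refine average_mono_cube (hp i) _ (R.carrier_subset_inner_dil.trans (Cube.inner_subset _))
      (one_le_pow₀ (by norm_num)) ?_
    rw [Cube.volume_dil]
    simp
  refine h1.trans ?_
  gcongr
  by_contra! hlt
  exact hx (mem_iUnion.2 ⟨i, mem_biUnion hlt (R.carrier_subset_inner_dil hR)⟩)

theorem average_one_le_maximal {p : ℝ≥0∞} (hp : 1 ≤ p) {h : Space d → ℂ}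
    (hh : AEStronglyMeasurable h volume) {L : Cube d} {x : Space d}
    (hx : x ∈ L.dilate (2 ^ 5)) : average h 1 L ≤ 32 ^ d * maximal p h x := by
  refine (average_one_le hp hh L).trans ?_
  have h1 : average h p L ≤ 32 ^ d * average h p (L.dil (2 ^ 5) (by norm_num)) := by
    refine average_mono_cube hp _ ?_ (one_le_pow₀ (by norm_num)) ?_
    · rw [Cube.carrier_dil]
      exact L.carrier_subset_dilate (by norm_num)
    · rw [Cube.volume_dil]
      norm_num
  refine h1.trans ?_
  gcongr
  exact le_iSup₂_of_le (f := fun (R : Cube d) (_ : x ∈ R.carrier) => average h p R) _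
    (by rwa [Cube.carrier_dil]) le_rfl

/-- The stopping collection adapted to a tuple of functions supported in `3Q`. -/
theorem exists_stoppingCollection (hd : 1 ≤ d) (m : ℕ) : ∃ A : ℝ≥0, 1 ≤ A ∧
    ∀ (v : Space d) (Q : Cube d), Q ∈ dyadicLattice v →
    ∀ p : Fin (m + 1) → ℝ≥0∞, (∀ i, 1 ≤ p i) →
    ∀ h : Fin (m + 1) → Space d → ℂ, (∀ i, IsTest (h i)) →
      (∀ i, Function.support (h i) ⊆ Q.dilate 3) →
      (∀ i, average (h i) (p i) (Q.dil 3 three_pos) ≠ 0) →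
    ∃ P : Set (Cube d), IsStoppingCollection (dyadicLattice v) P Q ∧
      ∑' L : P, volume (L : Cube d).carrier ≤ volume Q.carrier / 2 ∧
      ∀ i, IsControlled P (p i) (A * average (h i) (p i) (Q.dil 3 three_pos)) (h i) := by
  obtain ⟨B, hB1, hB⟩ := ae_enorm_le_of_average_le d
  -- `480 = 5 * 3 * 32`: Vitali's constant, the passage from `|3Q|` to `|Q|`, and the target `|E| ≤
  -- 32^{-d} |Q|`. The factor `m + 1` pays for the union over the functions.
  set C : ℝ≥0 := (m + 1) * 480 ^ d with hC
  have hC1 : 1 ≤ C := one_le_mul (by simp) (one_le_pow₀ (by norm_num))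
  have hA1 : 1 ≤ B * 64 ^ d * C :=
    one_le_mul (one_le_mul hB1 (one_le_pow₀ (by norm_num))) hC1
  -- `64 = 2 * 32` combines the loss outside the exceptional set with the passage from `L` to `32L`;
  -- `B` comes from Lebesgue differentiation.
  refine ⟨B * 64 ^ d * C, hA1, fun v Q hQ p hp h hh hsupp ha0 => ?_⟩
  set Q3 := Q.dil 3 three_pos
  have hQ3 : Q3.carrier = Q.dilate 3 := Cube.carrier_dil _ _ _
  set a : Fin (m + 1) → ℝ≥0∞ := fun i => average (h i) (p i) Q3 with ha
  set E := exceptionalSet p h C a with hE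
  have hEo : IsOpen E := isOpen_exceptionalSet _ _ _ _
  have hCe : (C : ℝ≥0∞) = (m + 1) * 480 ^ d := by simp [hC]
  have hvol : volume E ≤ ENNReal.ofReal (1 / 32) ^ d * volume Q.carrier := by
    calc volume E ≤ ∑ i, volume (⋃ R ∈ {R : Cube d | C * a i < average (h i) (p i) R}, R.inner) := by
          rw [hE, exceptionalSet]
          exact measure_iUnion_fintype_le _ _
      _ ≤ ∑ _i : Fin (m + 1), 5 ^ d * (volume Q3.carrier / C) := by
          refine Finset.sum_le_sum fun i _ => ?_
          refine (measure_mono (iUnion₂_mono fun R _ => R.inner_subset)).trans ?_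
          obtain ⟨M, hM⟩ := (hh i).bdd
          exact volume_average_gt_le hd (hp i) (hQ3 ▸ hsupp i) (ha0 i) (average_ne_top hM _)
            (by exact_mod_cast hC1) ENNReal.coe_ne_top
      _ = _ := by
          rw [Finset.sum_const, Finset.card_univ, Fintype.card_fin, nsmul_eq_mul, Cube.volume_dil,
            hCe, ENNReal.ofReal_ofNat, ENNReal.ofReal_div_of_pos (by norm_num), ENNReal.ofReal_one,
            ENNReal.ofReal_ofNat]
          set V := volume Q.carrier
          have e1 : (480 : ℝ≥0∞) ^ d = 5 ^ d * 3 ^ d * 32 ^ d := by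
            rw [← mul_pow, ← mul_pow]; norm_num
          have hm0 : (m + 1 : ℝ≥0∞) ≠ 0 := by positivity
          have hmt : (m + 1 : ℝ≥0∞) ≠ ∞ := by finiteness
          rw [e1, div_eq_mul_inv, ENNReal.mul_inv (Or.inl hm0) (Or.inl hmt),
            ENNReal.mul_inv (Or.inl (by positivity)) (Or.inl (by finiteness)), one_div,
            ← ENNReal.inv_pow]
          push_cast
          have i1 := ENNReal.mul_inv_cancel hm0 hmt
          have i2 := ENNReal.mul_inv_cancel (a := (5 : ℝ≥0∞) ^ d * 3 ^ d) (by positivity)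
            (by finiteness)
          calc _ = ((m + 1 : ℝ≥0∞) * (m + 1 : ℝ≥0∞)⁻¹) * ((5 ^ d * 3 ^ d) * (5 ^ d * 3 ^ d)⁻¹) *
                (((32 : ℝ≥0∞) ^ d)⁻¹ * V) := by ring
            _ = _ := by rw [i1, i2]; simp
  have hmax : ∀ x ∉ E, ∀ i, maximal (p i) (h i) x ≤ 2 ^ d * (C * a i) := fun x hx i =>
    maximal_le_of_notMem_exceptionalSet hp hx i
  have hB1' : (1 : ℝ≥0∞) ≤ B := by exact_mod_cast hB1
  have hle : ∀ i, 32 ^ d * (2 ^ d * (C * a i)) ≤ ((B * 64 ^ d * C : ℝ≥0) : ℝ≥0∞) * a i := by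
    intro i
    calc 32 ^ d * (2 ^ d * (C * a i)) = 1 * (64 ^ d * C * a i) := by
          rw [show (64 : ℝ≥0∞) = 32 * 2 by norm_num, mul_pow]; ring
      _ ≤ B * (64 ^ d * C * a i) := by gcongr
      _ = _ := by push_cast; ring
  have hle' : ∀ i, 2 ^ d * (C * a i) ≤ ((B * 64 ^ d * C : ℝ≥0) : ℝ≥0∞) * a i := fun i =>
    le_trans (le_mul_of_one_le_left zero_le (one_le_pow₀ (by norm_num))) (hle i)
  have hBle : ∀ i, B * (2 ^ d * (C * a i)) ≤ ((B * 64 ^ d * C : ℝ≥0) : ℝ≥0∞) * a i := by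
    intro i
    calc B * (2 ^ d * (C * a i)) ≤ B * (64 ^ d * (C * a i)) := by gcongr; norm_num
      _ = _ := by push_cast; ring
  refine ⟨whitneyCubes v Q E, isStoppingCollection_whitneyCubes hd hQ hvol hEo, ?_, fun i => ?_⟩
  · refine tsum_volume_whitneyCubes_le.trans (hvol.trans ?_)
    rw [mul_comm, ENNReal.div_eq_inv_mul, mul_comm _ (volume Q.carrier)]
    refine mul_le_mul_right ?_ _
    calc ENNReal.ofReal (1 / 32) ^ d ≤ ENNReal.ofReal (1 / 32) ^ 1 :=
          pow_le_pow_right_of_le_one' (by simp) hd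
      _ ≤ 2⁻¹ := by
          rw [pow_one, ENNReal.ofReal_div_of_pos (by norm_num), ENNReal.ofReal_one,
            ENNReal.ofReal_ofNat, one_div]
          exact ENNReal.inv_le_inv.2 (by norm_num)
  have hpt : ∀ L ∈ whitneyCubes v Q E, ∃ x ∈ L.dilate (2 ^ 5), x ∉ E := by
    intro L hL
    obtain ⟨y, hy, hyE⟩ := exists_mem_dilate_notMem hd hQ hvol hL
    refine ⟨y, fun j => ?_, hyE⟩
    have := hy j
    have := L.side_pos
    constructor <;> linarith
  constructor
  · filter_upwards [hB (h i) (hh i).integrable.locallyIntegrable] with x hx hU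
    by_cases hxQ : x ∈ Q.dilate 3
    · have hxE : x ∉ E := fun hxE => hU (mem_iUnion_whitneyCubes hd hQ hvol hEo hxE hxQ)
      refine (hx _ fun R hR => ?_).trans (hBle i)
      exact (average_one_le (hp i) (hh i).aesm R).trans
        ((le_iSup₂_of_le (f := fun (R : Cube d) (_ : x ∈ R.carrier) => average (h i) (p i) R)
          R hR le_rfl).trans (hmax x hxE i))
    · have : h i x = 0 := by
        by_contra hne
        exact hxQ (hsupp i hne)
      simp [this]
  · intro L hL
    obtain ⟨x, hx, hxE⟩ := hpt L hL
    exact ⟨x, hx, (hmax x hxE i).trans (hle' i)⟩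
  · intro L hL
    obtain ⟨x, hx, hxE⟩ := hpt L hL
    refine (average_one_le_maximal (hp i) (hh i).aesm hx).trans (le_trans ?_ (hle i))
    gcongr
    exact hmax x hxE i
  · intro hpi
    have : eLpNorm (h i) ∞ volume = a i := by
      simp only [ha]
      rw [hpi, average_top, indicator_eq_self.2 (hQ3 ▸ hsupp i)]
    rw [this]
    exact le_mul_of_one_le_left zero_le (by exact_mod_cast hA1)

/-! ### The stopping form of a stopping collection adapted to the functions -/

/-- The bound for the stopping form, by telescoping over the good-bad decompositions of the
functions. -/
theorem enorm_stoppingForm_le {K : Kernels d m} {q : ℝ≥0∞} (hq : 1 ≤ q) (hK : IsSingleScale K q)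
    {ρ : Fin (m + 1) → ℝ≥0∞} (hρ1 : ∀ i, 1 ≤ ρ i) (hρ : ∑ i, (ρ i)⁻¹ = 1)
    {p : Fin (m + 1) → ℝ≥0∞} (hp : ∀ i, 1 ≤ p i) {C_L : ℝ≥0} (hbad : BadFunctionEstimates K p C_L)
    {v : Space d} {P : Set (Cube d)} {Q : Cube d} (hP : IsStoppingCollection (dyadicLattice v) P Q)
    (hPv : ∑' L : P, volume (L : Cube d).carrier ≤ volume Q.carrier)
    {h : Fin (m + 1) → Space d → ℂ} (hh : ∀ i, IsTest (h i))
    (hsupp : ∀ i, Function.support (h i) ⊆ Q.dilate 3) {t : Fin (m + 1) → ℝ≥0∞}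
    (ht0 : ∀ i, t i ≠ 0) (htt : ∀ i, t i ≠ ∞) (hc : ∀ i, IsControlled P (p i) (t i) (h i))
    (μ ν : ℤ) :
    ‖stoppingForm K μ ν P Q h‖ₑ ≤ ((m + 1) * 2 ^ (m + 1) * C_L + 2 * 3 ^ d * truncationBound K ρ) *
      (volume Q.carrier * ∏ i, t i) := by
  have hdis := hP.disjoint
  have hPt : ∑' L : P, volume (L : Cube d).carrier ≠ ∞ :=
    ne_top_of_le_ne_top Q.volume_carrier_ne_top hPv
  have hU : (⋃ L ∈ P, L.carrier) ⊆ Q.dilate 3 := iUnion₂_subset hP.contained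
  have hUb : Bornology.IsBounded (⋃ L ∈ P, L.carrier) := by
    refine (Q.dil 3 three_pos).isBounded_carrier.subset ?_
    rwa [Cube.carrier_dil]
  set g : Fin (m + 1) → Space d → ℂ := fun i => goodPart P (h i) with hg
  have hgt : ∀ i, IsTest (g i) := fun i => isTest_goodPart hdis hUb (hh i)
  have hgs : ∀ i, Function.support (g i) ⊆ Q.dilate 3 := fun i =>
    support_goodPart_subset.trans (union_subset (hsupp i) hU)
  have hgn : ∀ i, yNorm P ∞ (g i) ≤ t i := fun i => (hc i).yNorm_goodPart_le hdis
  set b : Fin (m + 1) → Space d → ℂ := fun i => h i - g i with hb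
  have hbt : ∀ i, IsTest (b i) := fun i => (hh i).sub (hgt i)
  have hbs : ∀ i, Function.support (b i) ⊆ Q.dilate 3 := fun i =>
    (Function.support_sub _ _).trans (union_subset (hsupp i) (hgs i))
  have hbn : ∀ i, yNorm P (p i) (b i) ≤ 2 * t i := fun i =>
    (hc i).yNorm_sub_goodPart_le hdis (hp i) (hh i).aesm
  set X := C_L * volume Q.carrier * ∏ i, (2 * t i) with hX
  -- Good parts before position `n`, untouched functions from `n` on: the pattern of exponents in
  -- `slotExponent`. The tuple `w` below is the difference of consecutive stages, with the bad part
  -- in slot `n`.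
  set tele : ℕ → Fin (m + 1) → Space d → ℂ := fun n j => if j.1 < n then g j else h j with htele
  have htelet : ∀ n j, IsTest (tele n j) := by
    intro n j
    simp only [htele]
    split_ifs
    exacts [hgt j, hh j]
  have hstep : ∀ n : Fin (m + 1), ‖stoppingForm K μ ν P Q (tele n)‖ₑ
      ≤ X + ‖stoppingForm K μ ν P Q (tele (n + 1))‖ₑ := by
    intro n
    set w : Fin (m + 1) → Space d → ℂ := fun j => if j < n then g j else if j = n then b j else h j
      with hw
    have hwt : ∀ j, IsTest (w j) := by
      intro j
      simp only [hw]
      split_ifs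
      exacts [hgt j, hbt j, hh j]
    have hwn : ∀ j, yNorm P (slotExponent p n j) (w j) ≤ 2 * t j := by
      intro j
      have h2 : t j ≤ 2 * t j := le_mul_of_one_le_left zero_le one_le_two
      simp only [hw, slotExponent]
      split_ifs
      exacts [(hgn j).trans h2, hbn j, (hc j).yNorm_le.trans h2]
    rw [stoppingForm_add hq hK μ ν hPt Q n hwt (htelet (n + 1)) (u := tele n)]
    · refine (enorm_add_le _ _).trans ?_
      gcongr
      refine (hbad μ ν _ P Q (isDyadicLattice_dyadicLattice v) hP n w (fun j => ⟨(hwt j).aesm, ?_,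
        (hwn j).trans_lt (ENNReal.mul_lt_top ENNReal.ofNat_lt_top (htt j).lt_top)⟩) ?_
        (fun s _ => integrable_kernel hq hK s hwt)).trans ?_
      · simp only [hw]
        split_ifs
        exacts [hgs j, hbs j, hsupp j]
      · simp only [hw, lt_irrefl, if_false, if_true]
        exact isMeanZeroOn_sub_goodPart hdis (hh n).integrable
      · rw [hX]
        gcongr
        exact hwn _
    · simp [hw, htele, hb]
    · intro j hj
      simp only [hw, htele, if_neg hj]
      by_cases hlt : j < n
      · rw [if_pos hlt, if_pos (Fin.lt_def.1 hlt)]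
      · rw [if_neg hlt, if_neg (fun h => hlt (Fin.lt_def.2 h))]
    · intro j hj
      have hj' : (j : ℕ) ≠ n := fun h => hj (Fin.ext h)
      have : (j : ℕ) < n + 1 ↔ (j : ℕ) < n := by omega
      simp [htele, this]
  have htel : ∀ n : ℕ, n ≤ m + 1 → ‖stoppingForm K μ ν P Q h‖ₑ
      ≤ n * X + ‖stoppingForm K μ ν P Q (tele n)‖ₑ := by
    intro n
    induction n with
    | zero => intro _; simp [htele]
    | succ n ih =>
      intro hn
      refine (ih (by omega)).trans ?_
      have := hstep ⟨n, by omega⟩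
      calc _ ≤ n * X + (X + ‖stoppingForm K μ ν P Q (tele (n + 1))‖ₑ) := by gcongr
        _ = _ := by push_cast; ring
  have hlast : tele (m + 1) = g := by
    funext j
    simp only [htele]
    rw [if_pos j.2]
  -- No cancellation is needed for the good parts: `Λ_Q` and the `Λ_L` are bounded separately, and
  -- `∑ |L| ≤ |Q|` accounts for the factor `2`.
  have hgood : ‖stoppingForm K μ ν P Q g‖ₑ
      ≤ 2 * 3 ^ d * truncationBound K ρ * (volume Q.carrier * ∏ i, t i) := by
    obtain ⟨T, hT, hsum⟩ := exists_stoppingForm_eq_sum hPt Q μ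
    have hloc : ∀ L ∈ dyadicLattice v, ‖localForm K μ ν L g‖ₑ
        ≤ truncationBound K ρ * (3 ^ d * volume L.carrier * ∏ i, t i) := by
      intro L hL
      obtain ⟨k, n, hk, -⟩ := hL
      refine enorm_localForm_le hK hρ1 hρ μ ν hk (fun i => (hgt i).aesm) ht0 htt fun i => ?_
      have := hgn i
      rwa [yNorm_top_eq] at this
    have hTv : ∑ L ∈ T, volume L.carrier ≤ volume Q.carrier := by
      refine le_trans ?_ hPv
      rw [tsum_subtype P (fun L => volume L.carrier)]
      refine le_trans (Finset.sum_le_sum fun L hL => ?_) (ENNReal.sum_le_tsum T)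
      rw [indicator_of_mem ((hT L).1 hL).1.1]
    rw [hsum]
    calc ‖localForm K μ ν Q g - ∑ L ∈ T, localForm K μ ν L g‖ₑ
        ≤ ‖localForm K μ ν Q g‖ₑ + ∑ L ∈ T, ‖localForm K μ ν L g‖ₑ :=
          enorm_sub_le.trans (add_le_add le_rfl (enorm_sum_le _ _))
      _ ≤ truncationBound K ρ * (3 ^ d * volume Q.carrier * ∏ i, t i) +
            ∑ L ∈ T, truncationBound K ρ * (3 ^ d * volume L.carrier * ∏ i, t i) :=
          add_le_add (hloc Q hP.top_mem)
            (Finset.sum_le_sum fun L hL => hloc L (hP.subset ((hT L).1 hL).1.1))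
      _ = truncationBound K ρ * 3 ^ d * (∏ i, t i) *
            (volume Q.carrier + ∑ L ∈ T, volume L.carrier) := by
          rw [mul_add, Finset.mul_sum]
          congr 1
          · ring
          · exact Finset.sum_congr rfl fun L _ => by ring
      _ ≤ truncationBound K ρ * 3 ^ d * (∏ i, t i) * (volume Q.carrier + volume Q.carrier) := by
          gcongr
      _ = _ := by ring
  refine (htel (m + 1) le_rfl).trans ?_
  rw [hlast]
  refine (add_le_add le_rfl hgood).trans (le_of_eq ?_)
  rw [hX, Finset.prod_mul_distrib, Finset.prod_const, Finset.card_univ, Fintype.card_fin]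
  push_cast
  ring

/-! ### Iteration -/

/-- The localized forms are dominated by sparse forms over finite families of cubes. -/
theorem exists_sparse_family (hd : 1 ≤ d) (m : ℕ) : ∃ A : ℝ≥0,
    ∀ (K : Kernels d m) (q : ℝ≥0∞), 1 ≤ q → IsSingleScale K q →
    ∀ ρ : Fin (m + 1) → ℝ≥0∞, (∀ i, 1 ≤ ρ i) → ∑ i, (ρ i)⁻¹ = 1 →
    ∀ p : Fin (m + 1) → ℝ≥0∞, (∀ i, 1 ≤ p i) →
    ∀ C_L : ℝ≥0, BadFunctionEstimates K p C_L →
    ∀ f : Fin (m + 1) → Space d → ℂ, (∀ i, IsTest (f i)) →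
    ∀ (v : Space d) (μ ν : ℤ) (N : ℕ) (Q : Cube d), Q ∈ dyadicLattice v → Q.scale ≤ μ + N →
    ∃ (ι : Type) (_ : Fintype ι) (R : ι → Cube d) (E : ι → Set (Space d)),
      (∀ i, MeasurableSet (E i) ∧ E i ⊆ Q.carrier ∧ E i ⊆ (R i).carrier ∧
        volume (R i).carrier ≤ 2 * volume (E i)) ∧
      Pairwise (Function.onFun Disjoint E) ∧
      ‖localForm K μ ν Q f‖ₑ ≤ A * (truncationBound K ρ + C_L) *
        ∑ i, volume (R i).carrier * ∏ j, average (f j) (p j) ((R i).dil 3 three_pos) := by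
  obtain ⟨A, hA1, hA⟩ := exists_stoppingCollection hd m
  refine ⟨((m + 1) * 2 ^ (m + 1) + 2 * 3 ^ d) * A ^ (m + 1),
    fun K q hq hK ρ hρ1 hρ p hp C_L hbad f hf v μ ν N => ?_⟩
  have hA0 : (A : ℝ≥0∞) ≠ 0 := by exact_mod_cast (zero_lt_one.trans_le hA1).ne'
  set W := ((((m + 1) * 2 ^ (m + 1) + 2 * 3 ^ d) * A ^ (m + 1) : ℝ≥0) : ℝ≥0∞) *
    (truncationBound K ρ + C_L) with hW
  have hempty : ∀ Q : Cube d, localForm K μ ν Q f = 0 →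
      ∃ (ι : Type) (_ : Fintype ι) (R : ι → Cube d) (E : ι → Set (Space d)),
      (∀ i, MeasurableSet (E i) ∧ E i ⊆ Q.carrier ∧ E i ⊆ (R i).carrier ∧
        volume (R i).carrier ≤ 2 * volume (E i)) ∧
      Pairwise (Function.onFun Disjoint E) ∧
      ‖localForm K μ ν Q f‖ₑ ≤ W *
        ∑ i, volume (R i).carrier * ∏ j, average (f j) (p j) ((R i).dil 3 three_pos) :=
    fun Q h0 => ⟨Empty, inferInstance, fun i => i.elim, fun i => i.elim, fun i => i.elim,
      fun i => i.elim, by simp [h0]⟩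
  -- `N` bounds how far the scale of `Q` lies above `μ`; at `N = 0` no scale is left in the form.
  induction N with
  | zero =>
    intro Q _ hs
    exact hempty Q (localForm_eq_zero_of_scale_le (by simpa using hs) f)
  | succ N ih =>
    intro Q hQ hs
    set Q3 := Q.dil 3 three_pos with hQ3def
    have hQ3 : Q3.carrier = Q.dilate 3 := Cube.carrier_dil _ _ _
    obtain ⟨k, n, hk, -⟩ := id hQ
    set h : Fin (m + 1) → Space d → ℂ := fun j => Q3.carrier.indicator (f j) with hh
    have hht : ∀ i, IsTest (h i) := fun i => (hf i).indicator Q3.measurableSet_carrier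
    have hloc : localForm K μ ν Q f = localForm K μ ν Q h :=
      localForm_congr hK μ ν hk fun j x hx => by
        rw [hh]; simp only; rw [indicator_of_mem (by rwa [hQ3])]
    have hav : ∀ j, average (h j) (p j) Q3 = average (f j) (p j) Q3 := by
      intro j
      simp only [average, hh, indicator_indicator, inter_self]
    -- The stopping collection is only built for nonzero averages; if one vanishes, so does that
    -- function on `3Q`, and with it the form.
    by_cases ha0 : ∃ j, average (f j) (p j) Q3 = 0
    · obtain ⟨j, hj⟩ := ha0
      refine hempty Q ?_
      rw [hloc]
      exact localForm_eq_zero_of_ae μ ν Q (n := j) (average_eq_zero (hp j) (hf j).aesm hj)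
    push Not at ha0
    have hhs : ∀ i, Function.support (h i) ⊆ Q.dilate 3 := by
      intro i
      rw [hh, Set.support_indicator, hQ3]
      exact inter_subset_left
    obtain ⟨P, hP, hPv, hc⟩ := hA v Q hQ p hp h hht hhs (fun i => by rw [hav]; exact ha0 i)
    simp only [← hQ3def, hav] at hc
    have hPQ : ∑' L : P, volume (L : Cube d).carrier ≤ volume Q.carrier :=
      hPv.trans ENNReal.half_le_self
    have hfin : ∀ j, average (f j) (p j) Q3 ≠ ∞ := fun j => by
      obtain ⟨M, hM⟩ := (hf j).bdd
      exact average_ne_top hM _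
    have hstopping := enorm_stoppingForm_le hq hK hρ1 hρ hp hbad hP hPQ hht hhs
      (fun i => mul_ne_zero hA0 (ha0 i)) (fun i => ENNReal.mul_ne_top ENNReal.coe_ne_top (hfin i))
      hc μ ν
    obtain ⟨T, hT, hsum⟩ := exists_stoppingForm_eq_sum
      (ne_top_of_le_ne_top Q.volume_carrier_ne_top hPQ) Q μ
    -- A stopping cube has volume at most `|Q|/2`, so it is strictly smaller than `Q` and its scale
    -- drops by at least one.
    have hTscale : ∀ L ∈ T, L.scale ≤ μ + N := by
      intro L hL
      obtain ⟨⟨hLP, hLQ⟩, -⟩ := (hT L).1 hL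
      obtain ⟨l, n', hl, -⟩ := hP.subset hLP
      have hvol : volume L.carrier < volume Q.carrier :=
        calc volume L.carrier ≤ ∑' L : P, volume (L : Cube d).carrier :=
              ENNReal.le_tsum (f := fun L : P => volume (L : Cube d).carrier) ⟨L, hLP⟩
          _ ≤ volume Q.carrier / 2 := hPv
          _ < volume Q.carrier :=
              ENNReal.half_lt_self Q.volume_carrier_ne_zero Q.volume_carrier_ne_top
      have hlk : l < k := by
        by_contra! hkl
        refine hvol.not_ge ?_
        rw [Cube.volume_carrier, Cube.volume_carrier, hk, hl]
        gcongr
        norm_num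
      rw [Cube.scale_of_side hk] at hs
      rw [Cube.scale_of_side hl]
      have h1 : ((l + 1 : ℤ) : ℝ) ≤ k := by exact_mod_cast hlk
      push_cast at h1 hs
      linarith
    have hchild := fun L : T => ih (L : Cube d) (hP.subset ((hT L).1 L.2).1.1) (hTscale L L.2)
    choose ι hι R E hE hEd hbound using hchild
    have hTmeas : MeasurableSet (⋃ L ∈ T, L.carrier) :=
      Finset.measurableSet_biUnion T fun L _ => L.measurableSet_carrier
    have hTvol : volume (⋃ L ∈ T, L.carrier) ≤ volume Q.carrier / 2 := by
      refine (measure_biUnion_finset_le T _).trans (le_trans ?_ hPv)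
      rw [tsum_subtype P (fun L => volume L.carrier)]
      refine le_trans (Finset.sum_le_sum fun L hL => ?_) (ENNReal.sum_le_tsum T)
      rw [indicator_of_mem ((hT L).1 hL).1.1]
    -- The new family is `Q` together with the families of its stopping cubes, and `Q` receives the
    -- part of itself they leave free.
    refine ⟨Option (Σ L : T, ι L), inferInstance, fun i => i.elim Q fun i => R i.1 i.2,
      fun i => i.elim (Q.carrier \ ⋃ L ∈ T, L.carrier) fun i => E i.1 i.2, ?_, ?_, ?_⟩
    · rintro (_ | ⟨L, i⟩)
      · refine ⟨Q.measurableSet_carrier.diff hTmeas, sdiff_subset, sdiff_subset, ?_⟩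
        change volume Q.carrier ≤ 2 * volume (Q.carrier \ ⋃ L ∈ T, L.carrier)
        have h1 : volume Q.carrier / 2 ≤ volume (Q.carrier \ ⋃ L ∈ T, L.carrier) := by
          refine le_trans ?_ le_measure_sdiff
          refine le_trans ?_ (tsub_le_tsub_left hTvol _)
          rw [ENNReal.sub_half Q.volume_carrier_ne_top]
        calc volume Q.carrier = 2 * (volume Q.carrier / 2) :=
              (ENNReal.mul_div_cancel (by norm_num) (by norm_num)).symm
          _ ≤ _ := by gcongr
      · obtain ⟨h1, h2, h3, h4⟩ := hE L i
        exact ⟨h1, h2.trans ((hT L).1 L.2).1.2, h3, h4⟩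
    · have hnone : ∀ L : T, ∀ i : ι L,
          Disjoint (Q.carrier \ ⋃ L ∈ T, L.carrier) (E L i) := fun L i =>
        disjoint_sdiff_left.mono_right ((hE L i).2.1.trans
          (subset_biUnion_of_mem (u := fun L : Cube d => L.carrier) L.2))
      rintro (_ | ⟨L, i⟩) (_ | ⟨L', i'⟩) hne
      · exact absurd rfl hne
      · exact hnone L' i'
      · exact (hnone L i).symm
      · by_cases hLL : L = L'
        · subst hLL
          exact hEd L fun h : i = i' => hne (by rw [h])
        · exact (hP.disjoint ((hT L).1 L.2).1.1 ((hT L').1 L'.2).1.1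
            fun h => hLL (Subtype.ext h)).mono (hE L i).2.1 (hE L' i').2.1
    -- The recursion continues with `f` rather than `h`: the two agree on `3L ⊆ 3Q`, so they have
    -- the same `Λ_L`.
    · have hsplit : localForm K μ ν Q f
          = stoppingForm K μ ν P Q h + ∑ L : T, localForm K μ ν (L : Cube d) f := by
        rw [hsum, hloc, Finset.sum_coe_sort T fun L => localForm K μ ν L f, sub_add,
          ← Finset.sum_sub_distrib, Finset.sum_eq_zero, sub_zero]
        intro L hL
        obtain ⟨⟨hLP, hLQ⟩, -⟩ := (hT L).1 hL
        obtain ⟨l, n', hl, -⟩ := hP.subset hLP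
        rw [sub_eq_zero]
        refine localForm_congr hK μ ν hl fun j x hx => ?_
        rw [hh]
        simp only
        rw [indicator_of_mem (by rw [hQ3]; exact Cube.dilate_three_subset hLQ hx)]
      rw [hsplit, Fintype.sum_option, Fintype.sum_sigma, mul_add, Finset.mul_sum]
      refine (enorm_add_le _ _).trans (add_le_add (hstopping.trans ?_)
        ((enorm_sum_le _ _).trans (Finset.sum_le_sum fun L _ => hbound L)))
      rw [Finset.prod_mul_distrib, Finset.prod_const, Finset.card_univ, Fintype.card_fin]
      change _ ≤ W * (volume Q.carrier * ∏ j, average (f j) (p j) Q3)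
      rw [hW]
      push_cast
      set G := ∏ j, average (f j) (p j) Q3
      calc _ = (((m + 1) * 2 ^ (m + 1)) * C_L + 2 * 3 ^ d * truncationBound K ρ) *
            ((A : ℝ≥0∞) ^ (m + 1) * (volume Q.carrier * G)) := by ring
        _ ≤ (((m + 1) * 2 ^ (m + 1)) * (truncationBound K ρ + C_L) +
              2 * 3 ^ d * (truncationBound K ρ + C_L)) *
            ((A : ℝ≥0∞) ^ (m + 1) * (volume Q.carrier * G)) := by
            gcongr
            · exact le_add_self
            · exact le_self_add
        _ = _ := by ring

/-! ### Multiplicities in sparse collections -/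

/-- Intermediate value theorem for the volume of `E` inside the ball of radius `r`. It is continuous
because its increments are dominated by those of the volume of the ball, and it starts at zero since
`d ≥ 1`. -/
theorem exists_subset_volume_eq (hd : 1 ≤ d) {E : Set (Space d)} (hE : MeasurableSet E)
    (hb : Bornology.IsBounded E) {c : ℝ≥0∞} (hc : c ≤ volume E) :
    ∃ E' ⊆ E, MeasurableSet E' ∧ volume E' = c := by
  have hne : Nonempty (Fin d) := ⟨⟨0, hd⟩⟩
  have hEt : volume E ≠ ∞ := hb.measure_lt_top.ne
  obtain ⟨R, hR0, hR⟩ := hb.subset_closedBall_lt 0 0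
  set F : ℝ → ℝ := fun r => volume.real (E ∩ Metric.closedBall 0 r) with hF
  set ω := volume.real (Metric.ball (0 : Space d) 1) with hω
  have hG : ∀ r : ℝ, 0 ≤ r → volume.real (Metric.closedBall (0 : Space d) r) = r ^ d * ω := by
    intro r hr
    rw [measureReal_def, Measure.addHaar_closedBall _ _ hr, ENNReal.toReal_mul,
      ENNReal.toReal_ofReal (by positivity)]
    simp [hω, measureReal_def]
  have hmono : ∀ r s : ℝ, 0 ≤ r → r ≤ s → |F s - F r| ≤ |s ^ d * ω - r ^ d * ω| := by
    intro r s hr hrs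
    have hsub : Metric.closedBall (0 : Space d) r ⊆ Metric.closedBall 0 s :=
      Metric.closedBall_subset_closedBall hrs
    have hBt : ∀ r, volume (Metric.closedBall (0 : Space d) r) ≠ ∞ := fun r =>
      measure_closedBall_lt_top.ne
    have h1 : F r ≤ F s := measureReal_mono (inter_subset_inter_right _ hsub)
      (measure_ne_top_of_subset inter_subset_left hEt)
    have h2 : F s ≤ F r + volume.real (Metric.closedBall (0 : Space d) s \ Metric.closedBall 0 r) := by
      refine (measureReal_mono ?_ ?_).trans (measureReal_union_le _ _)
      · intro x hx
        by_cases hxr : x ∈ Metric.closedBall (0 : Space d) r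
        · exact Or.inl ⟨hx.1, hxr⟩
        · exact Or.inr ⟨hx.2, hxr⟩
      · exact measure_union_ne_top (measure_ne_top_of_subset inter_subset_left hEt)
          (measure_ne_top_of_subset sdiff_subset (hBt s))
    rw [measureReal_sdiff hsub Metric.isClosed_closedBall.measurableSet (hBt _),
      hG s (hr.trans hrs), hG r hr] at h2
    rw [abs_of_nonneg (by linarith)]
    exact le_trans (by linarith) (le_abs_self _)
  have hmono' : ∀ r s : ℝ, 0 ≤ r → 0 ≤ s → |F s - F r| ≤ |s ^ d * ω - r ^ d * ω| := by
    intro r s hr hs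
    rcases le_total r s with h | h
    · exact hmono r s hr h
    · rw [abs_sub_comm, abs_sub_comm (s ^ d * ω)]
      exact hmono s r hs h
  have hcont : ContinuousOn F (Icc 0 R) := by
    intro r hr
    rw [ContinuousWithinAt, tendsto_iff_dist_tendsto_zero]
    have hlim : Filter.Tendsto (fun s : ℝ => |s ^ d * ω - r ^ d * ω|) (nhdsWithin r (Icc 0 R))
        (nhds 0) := by
      have : Continuous fun s : ℝ => |s ^ d * ω - r ^ d * ω| := by fun_prop
      simpa using (this.tendsto r).mono_left nhdsWithin_le_nhds
    refine squeeze_zero' (.of_forall fun _ => dist_nonneg) ?_ hlim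
    filter_upwards [self_mem_nhdsWithin] with s hs
    rw [Real.dist_eq]
    exact hmono' r s hr.1 hs.1
  have hF0 : F 0 = 0 := by
    have h1 : F 0 ≤ volume.real (Metric.closedBall (0 : Space d) 0) :=
      measureReal_mono inter_subset_right measure_closedBall_lt_top.ne
    rw [hG 0 le_rfl, zero_pow (by omega), zero_mul] at h1
    exact le_antisymm h1 measureReal_nonneg
  have hFR : F R = volume.real E := by
    simp only [hF]
    rw [inter_eq_left.2 hR]
  have hct : c ≠ ∞ := ne_top_of_le_ne_top hEt hc
  obtain ⟨r, -, hr⟩ := intermediate_value_Icc hR0.le hcont (show c.toReal ∈ Icc (F 0) (F R) by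
    rw [hF0, hFR]
    exact ⟨ENNReal.toReal_nonneg, ENNReal.toReal_mono hEt hc⟩)
  refine ⟨E ∩ Metric.closedBall 0 r, inter_subset_left,
    hE.inter Metric.isClosed_closedBall.measurableSet, ?_⟩
  exact (ENNReal.toReal_eq_toReal_iff' (measure_ne_top_of_subset inter_subset_left hEt) hct).1 hr

theorem exists_disjoint_subsets_volume_eq (hd : 1 ≤ d) (M : ℕ) (c : ℝ≥0∞) :
    ∀ E : Set (Space d), MeasurableSet E → Bornology.IsBounded E → M * c ≤ volume E →
    ∃ F : Fin M → Set (Space d), (∀ k, MeasurableSet (F k) ∧ F k ⊆ E ∧ volume (F k) = c) ∧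
      Pairwise (Function.onFun Disjoint F) := by
  induction M with
  | zero => exact fun E _ _ _ => ⟨fun k => k.elim0, fun k => k.elim0, fun k => k.elim0⟩
  | succ M ih =>
    intro E hE hb hc
    have hEt : volume E ≠ ∞ := hb.measure_lt_top.ne
    push_cast at hc
    have hcE : c ≤ volume E := by
      refine le_trans ?_ hc
      rw [add_mul, one_mul]
      exact le_add_self
    obtain ⟨A, hAE, hA, hAc⟩ := exists_subset_volume_eq hd hE hb hcE
    have hct : c ≠ ∞ := ne_top_of_le_ne_top hEt hcE
    obtain ⟨F, hF, hFd⟩ := ih (E \ A) (hE.diff hA) (hb.subset sdiff_subset) (by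
      refine le_trans ?_ le_measure_sdiff
      rw [hAc]
      refine ENNReal.le_sub_of_add_le_right hct ?_
      rwa [add_mul, one_mul] at hc)
    have hAF : ∀ k, Disjoint A (F k) := fun k => disjoint_sdiff_right.mono_right (hF k).2.1
    refine ⟨Fin.cons A F, fun k => ?_, fun k l hkl => ?_⟩
    · refine Fin.cases ⟨hA, hAE, hAc⟩ (fun k => ?_) k
      exact ⟨(hF k).1, (hF k).2.1.trans sdiff_subset, (hF k).2.2⟩
    · induction k using Fin.cases with
      | zero =>
        induction l using Fin.cases with
        | zero => exact absurd rfl hkl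
        | succ l => simpa [Function.onFun] using hAF l
      | succ k =>
        induction l using Fin.cases with
        | zero => simpa [Function.onFun] using (hAF k).symm
        | succ l =>
          simpa [Function.onFun] using hFd (i := k) (j := l) fun h => hkl (by rw [h])

/-- Hall's marriage theorem for finite subsets with as many elements as `ι`. -/
theorem exists_injective_mem_of_infinite {ι α : Type*} [Finite ι] (s : ι → Set α)
    (hs : ∀ i, (s i).Infinite) : ∃ f : ι → α, Function.Injective f ∧ ∀ i, f i ∈ s i := by
  classical
  have := Fintype.ofFinite ι
  choose t hts htc using fun i => (hs i).exists_subset_card_eq (Fintype.card ι)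
  obtain ⟨f, hf, hft⟩ := (Finset.all_card_le_biUnion_card_iff_exists_injective t).1 fun T => by
    rcases T.eq_empty_or_nonempty with rfl | ⟨i, hi⟩
    · simp
    · refine (Finset.card_le_univ T).trans ?_
      rw [← htc i]
      exact Finset.card_le_card (Finset.subset_biUnion_of_mem t hi)
  exact ⟨f, hf, fun i => hts i (hft i)⟩

/-- Replacing every cube of a sparse family by `M` slightly larger cubes multiplies the sparse form
by `M`, up to a fixed factor, at the price of a smaller sparsity constant. -/
theorem nat_mul_sum_le_iSup_PSF (hd : 1 ≤ d) {p : Fin (m + 1) → ℝ≥0∞} (hp : ∀ i, 1 ≤ p i)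
    (f : Fin (m + 1) → Space d → ℂ) {ι : Type} [Fintype ι] (R : ι → Cube d)
    (E : ι → Set (Space d)) (hE : ∀ i, MeasurableSet (E i) ∧ E i ⊆ (R i).carrier)
    (hEd : Pairwise (Function.onFun Disjoint E)) {η : ℝ} {M : ℕ}
    (hη : ∀ i, M * (ENNReal.ofReal η * (2 ^ d * volume (R i).carrier)) ≤ volume (E i)) :
    M * ∑ i, volume (R i).carrier * ∏ j, average (f j) (p j) (R i) ≤
      (2 ^ d) ^ (m + 1) * ⨆ (S : Set (Cube d)) (_ : IsSparse η S), PSF S p f := by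
  -- A sparse collection is a set, so copies must be distinct cubes. Distinct side lengths ensure
  -- this, even if the given cubes repeat.
  obtain ⟨t, htinj, ht⟩ := exists_injective_mem_of_infinite
    (fun i : ι × Fin M => Ioo (R i.1).side (2 * (R i.1).side)) fun i =>
      Ioo_infinite (by have := (R i.1).side_pos; linarith)
  set R' : ι × Fin M → Cube d := fun i =>
    ⟨(R i.1).corner, t i, (R i.1).side_pos.trans (ht i).1⟩ with hR'
  have hinj : Function.Injective R' := fun i j hij => htinj (congrArg Cube.side hij)
  have hsub : ∀ i, (R i.1).carrier ⊆ (R' i).carrier := by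
    intro i x hx k
    have := hx k
    have := (ht i).1
    simp only [hR']
    constructor <;> linarith
  have hvol : ∀ i, volume (R' i).carrier ≤ 2 ^ d * volume (R i.1).carrier := by
    intro i
    rw [Cube.volume_carrier, Cube.volume_carrier, ← mul_pow]
    gcongr
    rw [← ENNReal.ofReal_ofNat 2, ← ENNReal.ofReal_mul (by norm_num)]
    exact ENNReal.ofReal_le_ofReal (ht i).2.le
  choose F hF hFd using fun i => exists_disjoint_subsets_volume_eq hd M _ (E i) (hE i).1
    ((R i).isBounded_carrier.subset (hE i).2) (hη i)
  set E' : Cube d → Set (Space d) := Function.extend R' (fun i => F i.1 i.2) fun _ => ∅ with hE'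
  have hE'R : ∀ i, E' (R' i) = F i.1 i.2 := fun i => hinj.extend_apply _ _ i
  have hsparse : IsSparse η (range R') := by
    refine ⟨E', ?_, ?_⟩
    · rintro _ ⟨i, rfl⟩
      rw [hE'R]
      obtain ⟨h1, h2, h3⟩ := hF i.1 i.2
      refine ⟨h1, h2.trans ((hE i.1).2.trans (hsub i)), ?_⟩
      rw [h3]
      gcongr
      exact hvol i
    · rintro _ ⟨i, rfl⟩ _ ⟨j, rfl⟩ hne
      rw [Function.onFun, hE'R, hE'R]
      obtain ⟨i, k⟩ := i
      obtain ⟨j, l⟩ := j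
      by_cases hij : i = j
      · subst hij
        exact hFd i fun h : k = l => hne (by rw [h])
      · exact (hEd hij).mono (hF i k).2.1 (hF j l).2.1
  have hPSF : PSF (range R') p f
      = ∑ i, volume (R' i).carrier * ∏ j, average (f j) (p j) (R' i) := by
    unfold PSF
    rw [tsum_range (fun Q : Cube d => volume Q.carrier * ∏ j, average (f j) (p j) Q) hinj,
      tsum_fintype]
  calc M * ∑ i, volume (R i).carrier * ∏ j, average (f j) (p j) (R i)
      = ∑ i : ι × Fin M, volume (R i.1).carrier * ∏ j, average (f j) (p j) (R i.1) := by
        rw [Fintype.sum_prod_type, Finset.mul_sum]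
        simp
    _ ≤ ∑ i : ι × Fin M, (2 ^ d) ^ (m + 1) *
          (volume (R' i).carrier * ∏ j, average (f j) (p j) (R' i)) := by
        refine Finset.sum_le_sum fun i _ => ?_
        calc volume (R i.1).carrier * ∏ j, average (f j) (p j) (R i.1)
            ≤ volume (R' i).carrier * ∏ j, (2 ^ d * average (f j) (p j) (R' i)) := by
              refine mul_le_mul' (measure_mono (hsub i)) (Finset.prod_le_prod' fun j _ => ?_)
              exact average_mono_cube (hp j) _ (hsub i) (one_le_pow₀ (by norm_num)) (hvol i)
          _ = _ := by
              rw [Finset.prod_mul_distrib, Finset.prod_const, Finset.card_univ, Fintype.card_fin]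
              ring
    _ = (2 ^ d) ^ (m + 1) * PSF (range R') p f := by rw [hPSF, Finset.mul_sum]
    _ ≤ _ := by
        gcongr
        exact le_iSup₂_of_le (f := fun S (_ : IsSparse η S) => PSF S p f) _ hsparse le_rfl

/-! ### The domination theorem -/

/-- Every truncated form applied to functions of bounded support is a localized form. -/
theorem exists_truncForm_eq_localForm (ν : ℤ) {f : Fin (m + 1) → Space d → ℂ}
    (hf : ∀ i, IsTest (f i)) : ∃ (v : Space d) (Q : Cube d), Q ∈ dyadicLattice v ∧
      ∀ (K : Kernels d m) (μ : ℤ), truncForm K μ ν f = localForm K μ ν Q f := by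
  obtain ⟨r, hr⟩ := (hf 0).supp.subset_closedBall 0
  obtain ⟨n, hn⟩ := pow_unbounded_of_one_lt r (one_lt_two (α := ℝ))
  -- Large enough for both the support of `f 0` and all the scales below `ν`.
  set k : ℤ := max n ν with hk
  have hrk : r < 2 ^ k := by
    refine hn.trans_le ?_
    rw [← zpow_natCast, zpow_two_le_iff]
    exact le_max_left _ _
  -- The translation makes `[-2^k, 2^k)^d` a cube of the lattice; in the standard lattice no cube
  -- contains a neighbourhood of the origin.
  refine ⟨WithLp.toLp 2 fun _ => -2 ^ k, dyadicCube _ (k + 1) 0, dyadicCube_mem _ _ _,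
    fun K μ => ?_⟩
  set Q := dyadicCube (WithLp.toLp 2 fun _ => -2 ^ k : Space d) (k + 1) 0 with hQ
  have hsupp : Function.support (f 0) ⊆ Q.carrier := by
    intro x hx i
    have h1 : |x i| ≤ r := by
      have := PiLp.norm_apply_le x i
      rw [Real.norm_eq_abs] at this
      exact this.trans (by simpa using hr hx)
    have h2 := abs_le.1 h1
    simp only [hQ, dyadicCube, Pi.zero_apply, Int.cast_zero, mul_zero, add_zero,
      zpow_add_one₀ (two_ne_zero (α := ℝ))]
    constructor <;> linarith
  have hupd : Function.update f 0 (Q.carrier.indicator (f 0)) = f := by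
    rw [indicator_eq_self.2 hsupp, Function.update_eq_self]
  unfold localForm truncForm
  rw [hupd]
  congr 1
  rw [eq_comm, Finset.filter_eq_self]
  intro s hs
  rw [Cube.scale_of_side (Q := Q) (k := k + 1) rfl]
  have h1 := (Finset.mem_Ioo.1 hs).2
  have h2 : ν ≤ k := le_max_right _ _
  exact_mod_cast (by omega : s ≤ k + 1)

/-- Sparse domination for bounded functions of bounded support. -/
theorem exists_sparsity_constant (hd : 1 ≤ d) (m : ℕ) : ∃ η : ℝ, 0 < η ∧ η < 1 ∧
    ∀ (K : Kernels d m) (q : ℝ≥0∞), 1 ≤ q → IsSingleScale K q →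
    ∀ ρ : Fin (m + 1) → ℝ≥0∞, (∀ i, 1 ≤ ρ i) → ∑ i, (ρ i)⁻¹ = 1 →
    ∀ p : Fin (m + 1) → ℝ≥0∞, (∀ i, 1 ≤ p i) →
    ∀ C_L : ℝ≥0, BadFunctionEstimates K p C_L →
    ∀ f : Fin (m + 1) → Space d → ℂ, (∀ i, IsTest (f i)) → ∀ μ ν : ℤ,
      ‖truncForm K μ ν f‖ₑ ≤ (truncationBound K ρ + C_L) *
        ⨆ (S : Set (Cube d)) (_ : IsSparse η S), PSF S p f := by
  obtain ⟨A, hA⟩ := exists_sparse_family hd m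
  -- The multiplicity outweighs both `A` and the loss from enlarging the cubes.
  obtain ⟨M, hM⟩ := exists_nat_ge (A * (2 ^ d) ^ (m + 1))
  -- `2` from `|R| ≤ 2|E|`, `6 = 3 * 2` from tripling and then enlarging the cubes, and `M + 1` for
  -- the division into `M` pieces, nonzero even if `M = 0`.
  set η : ℝ := 1 / (2 * 6 ^ d * (M + 1)) with hη
  have h6 : (1 : ℝ) ≤ 6 ^ d := one_le_pow₀ (by norm_num)
  have hden : (1 : ℝ) < 2 * 6 ^ d * (M + 1) := by
    have : (0 : ℝ) ≤ M := Nat.cast_nonneg _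
    nlinarith
  refine ⟨η, by positivity, by rw [hη, div_lt_one (by linarith)]; exact hden, ?_⟩
  intro K q hq hK ρ hρ1 hρ p hp C_L hbad f hf μ ν
  obtain ⟨v, Q, hQ, hform⟩ := exists_truncForm_eq_localForm ν hf
  obtain ⟨N, hN⟩ := exists_nat_ge (Q.scale - μ)
  obtain ⟨ι, hι, R, E, hE, hEd, hle⟩ := hA K q hq hK ρ hρ1 hρ p hp C_L hbad f hf v μ ν N Q hQ
    (by linarith)
  have hηe : ENNReal.ofReal η = (2 * 6 ^ d * (M + 1 : ℝ≥0∞))⁻¹ := by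
    rw [hη, one_div, ENNReal.ofReal_inv_of_pos (by linarith),
      ENNReal.ofReal_mul (by positivity), ENNReal.ofReal_mul (by positivity),
      ENNReal.ofReal_pow (by norm_num), ENNReal.ofReal_add (by positivity) (by norm_num)]
    simp
  have hsum := nat_mul_sum_le_iSup_PSF hd hp f (fun i => (R i).dil 3 three_pos) E
    (fun i => ⟨(hE i).1, (hE i).2.2.1.trans (by
      rw [Cube.carrier_dil]; exact (R i).carrier_subset_dilate (by norm_num))⟩) hEd
    (η := η) (M := M) (fun i => by
      obtain ⟨-, -, -, h4⟩ := hE i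
      rw [Cube.volume_dil, hηe, ENNReal.ofReal_ofNat]
      calc (M : ℝ≥0∞) * ((2 * 6 ^ d * (M + 1 : ℝ≥0∞))⁻¹ *
            (2 ^ d * (3 ^ d * volume (R i).carrier)))
          ≤ (M + 1 : ℝ≥0∞) * ((2 * 6 ^ d * (M + 1 : ℝ≥0∞))⁻¹ *
            (2 ^ d * (3 ^ d * (2 * volume (E i))))) := by
            gcongr
            exact le_self_add
        _ = (2 * 6 ^ d * (M + 1 : ℝ≥0∞)) * (2 * 6 ^ d * (M + 1 : ℝ≥0∞))⁻¹ * volume (E i) := by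
            rw [show (6 : ℝ≥0∞) = 2 * 3 by norm_num, mul_pow]
            ring
        _ = volume (E i) := by
            rw [ENNReal.mul_inv_cancel (by positivity) (by finiteness), one_mul])
  set X := ∑ i, volume ((R i).dil 3 three_pos).carrier *
    ∏ j, average (f j) (p j) ((R i).dil 3 three_pos) with hX
  set Z := ⨆ (S : Set (Cube d)) (_ : IsSparse η S), PSF S p f
  have hAX : A * X ≤ Z := by
    have h2 : ((2 : ℝ≥0∞) ^ d) ^ (m + 1) ≠ 0 := by positivity
    have h2t : ((2 : ℝ≥0∞) ^ d) ^ (m + 1) ≠ ∞ := by finiteness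
    refine (ENNReal.mul_le_mul_iff_right h2 h2t).1 (le_trans ?_ hsum)
    rw [← mul_assoc, mul_comm _ (A : ℝ≥0∞)]
    gcongr
    exact_mod_cast hM
  rw [hform]
  refine hle.trans ?_
  rw [mul_comm (A : ℝ≥0∞), mul_assoc]
  gcongr
  refine le_trans (mul_le_mul_right (Finset.sum_le_sum fun i _ =>
    mul_le_mul_left (measure_mono ?_) _) _) hAX
  rw [Cube.carrier_dil]
  exact (R _).carrier_subset_dilate (by norm_num)

/-! ### Passage to unbounded functions -/

/-- The truncation of `z` at height `k`. -/
noncomputable def cutoff (k : ℕ) (z : ℂ) : ℂ := (Metric.closedBall (0 : ℂ) k).indicator id z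

theorem measurable_cutoff (k : ℕ) : Measurable (cutoff k) :=
  measurable_id.indicator Metric.isClosed_closedBall.measurableSet

theorem norm_cutoff_le (k : ℕ) (z : ℂ) : ‖cutoff k z‖ ≤ ‖z‖ :=
  norm_indicator_le_norm_self id z

theorem norm_cutoff_le_nat (k : ℕ) (z : ℂ) : ‖cutoff k z‖ ≤ k := by
  unfold cutoff
  by_cases h : z ∈ Metric.closedBall (0 : ℂ) k
  · rw [indicator_of_mem h]
    simpa using h
  · rw [indicator_of_notMem h]
    simp

theorem cutoff_of_norm_le {k : ℕ} {z : ℂ} (h : ‖z‖ ≤ k) : cutoff k z = z := by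
  rw [cutoff, indicator_of_mem (by simpa using h), id]

theorem isTest_cutoff {f : Space d → ℂ} (hf : AEStronglyMeasurable f volume)
    (hs : HasCompactSupport f) (k : ℕ) : IsTest fun x => cutoff k (f x) where
  aesm := ((measurable_cutoff k).comp_aemeasurable hf.aemeasurable).aestronglyMeasurable
  bdd := ⟨k, fun x => norm_cutoff_le_nat k _⟩
  supp := by
    refine hs.isCompact.isBounded.subset fun x hx => subset_tsupport f fun h0 => hx ?_
    have := norm_cutoff_le k (f x)
    rw [h0, norm_zero] at this
    simpa [h0] using this

/-- Cutoffs do not increase absolute values, so the integrand of `f` dominates; at each point the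
cutoff integrands are eventually equal to it. -/
theorem tendsto_truncForm_cutoff {K : Kernels d m} {q : ℝ≥0∞} (hq : 1 ≤ q)
    (hK : IsSingleScale K q) (μ ν : ℤ) {f : Fin (m + 1) → Space d → ℂ}
    (hf : ∀ j, AEStronglyMeasurable (f j) volume ∧ HasCompactSupport (f j))
    (hint : Integrable (fun x : Fin (m + 1) → Space d =>
      (∑ s ∈ Finset.Ioo μ ν, K s x) * ∏ i, f i (x i)) volume) :
    Filter.Tendsto (fun k : ℕ => truncForm K μ ν fun i x => cutoff k (f i x)) Filter.atTop
      (nhds (truncForm K μ ν f)) := by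
  unfold truncForm form
  refine tendsto_integral_of_dominated_convergence _ (fun k => (integrable_sum_kernel hq hK _
    fun i => isTest_cutoff (hf i).1 (hf i).2 k).aestronglyMeasurable) hint.norm
    (fun k => .of_forall fun x => ?_) (.of_forall fun x => ?_)
  · rw [norm_mul, norm_mul, norm_prod, norm_prod]
    gcongr
    exact norm_cutoff_le _ _
  · obtain ⟨N, hN⟩ := exists_nat_ge (∑ i, ‖f i (x i)‖)
    refine tendsto_const_nhds.congr' ?_
    filter_upwards [Filter.eventually_ge_atTop N] with k hk
    congr 1
    refine Finset.prod_congr rfl fun i _ => (cutoff_of_norm_le ?_).symm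
    calc ‖f i (x i)‖ ≤ ∑ i, ‖f i (x i)‖ := Finset.single_le_sum
          (f := fun i => ‖f i (x i)‖) (fun _ _ => norm_nonneg _) (Finset.mem_univ i)
      _ ≤ N := hN
      _ ≤ k := by exact_mod_cast hk

end SparseForm

open SparseForm
theorem theorem2 (d : ℕ) (hd : 1 ≤ d) :
    -- the constant `c` depends only on `d`, the sparsity constant `η` only on `d` and `m`
    ∃ c : ℝ≥0, ∀ m : ℕ, 1 ≤ m → ∃ η : ℝ, 0 < η ∧ η < 1 ∧
      ∀ (K : Kernels d m) (q : ℝ≥0∞), 1 ≤ q → IsSingleScale K q →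
      ∀ (r : Fin m → ℝ≥0∞) (α α' : ℝ≥0∞), (∀ i, 1 ≤ r i) → 1 ≤ α → ∑ i, (r i)⁻¹ = α⁻¹ →
        α⁻¹ + α'⁻¹ = 1 →
        truncationBound K (Fin.snoc (α := fun _ => ℝ≥0∞) r α') < ∞ →
      ∀ (p : Fin (m + 1) → ℝ≥0∞), (∀ i, 1 ≤ p i) →
      ∀ C_L : ℝ≥0, 0 < C_L → BadFunctionEstimates K p C_L →
      ∀ f : Fin (m + 1) → Space d → ℂ,
        (∀ j, MemLp (f j) (p j) volume ∧ HasCompactSupport (f j)) →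
        (⨆ (μ : ℤ) (ν : ℤ), ‖truncForm K μ ν f‖ₑ) ≤
          c * (truncationBound K (Fin.snoc (α := fun _ => ℝ≥0∞) r α') + C_L) *
            ⨆ (S : Set (Cube d)) (_ : IsSparse η S), PSF S p f := by
  -- All constants have been absorbed into the sparsity constant.
  refine ⟨1, fun m _ => ?_⟩
  obtain ⟨η, hη0, hη1, hη⟩ := exists_sparsity_constant hd m
  refine ⟨η, hη0, hη1, fun K q hq hK r α α' hr _ hrα hαα' _ p hp C_L _ hbad f hf => ?_⟩
  refine iSup₂_le fun μ ν => ?_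
  -- Truncations whose integral does not converge have the default value zero, so they do not affect
  -- the supremum.
  by_cases hint : Integrable (fun x : Fin (m + 1) → Space d =>
      (∑ s ∈ Finset.Ioo μ ν, K s x) * ∏ i, f i (x i)) volume
  swap
  · rw [truncForm, form, integral_undef hint]
    simp
  have hα'1 : 1 ≤ α' := by
    rw [← ENNReal.inv_le_one, ← hαα']
    exact le_add_self
  have hf' : ∀ j, AEStronglyMeasurable (f j) volume ∧ HasCompactSupport (f j) := fun j =>
    ⟨(hf j).1.1, (hf j).2⟩
  refine le_of_tendsto (tendsto_truncForm_cutoff hq hK μ ν hf' hint).enorm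
    (.of_forall fun k => ?_)
  refine (hη K q hq hK (Fin.snoc (α := fun _ => ℝ≥0∞) r α') (fun i => ?_) ?_ p hp C_L hbad _
    (fun i => isTest_cutoff (hf' i).1 (hf' i).2 k) μ ν).trans ?_
  · induction i using Fin.lastCases with
    | last => simpa using hα'1
    | cast i => simpa using hr i
  · rw [Fin.sum_univ_castSucc]
    simp only [Fin.snoc_castSucc, Fin.snoc_last]
    rw [hrα, hαα']
  -- The sparse form of the cutoffs is at most that of `f`, so the bound is uniform in the height
  -- `k`.
  · rw [ENNReal.coe_one, one_mul]
    gcongr with S hS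
    unfold PSF
    gcongr
    exact average_mono_norm (fun x => norm_cutoff_le k _) _
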